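/- Let $0<p<1$. Let $\alpha_{i,j}$ ($i,j\in\mathbb Z$, $i<j$) be i.i.d. random variables on a probability space with $\mathbb P(\alpha_{i,j}=1)=p$ and $\mathbb P(\alpha_{i,j}=0)=1-p$. For real $x$ give the edge $(i,j)$, $i<j$, of the complete directed graph on $\mathbb Z$ the weight $w^x_{i,j}=\alpha_{i,j}+x(1-\alpha_{i,j})$; for $x=-\infty$ let $w^{-\infty}_{i,j}=1$ if $\alpha_{i,j}=1$ and $w^{-\infty}_{i,j}=-\infty$ otherwise. A path from $i$ to $j$ is a finite strictly increasing sequence of integers $(i_0,\dots,i_\ell)$ with $i_0=i$ and $i_\ell=j$; its weight is $\sum_{k=1}^{\ell} w^x_{i_{k-1},i_k}$. Let $W^x_{i,j}$ be the maximum weight of all paths from $i$ to $j$, and write $a^+=\max(a,0)$. **Theorem.** There are deterministic constants $C_p(-\infty)>0$ and $C_p(x)$, $x\in\mathbb R$, depending only on $p$ and, respectively, on $p$ and $x$ (not on the probability space or on the variables $\alpha_{i,j}$), such that $$\lim_{n\to\infty}\frac{(W^{-\infty}_{0,n})^+}{n}=C_p(-\infty)\quad\text{almost surely,}$$ and, for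 every real $x$, $$\lim_{n\to\infty}\frac{W^x_{0,n}}{n}=\lim_{n\to\infty}\frac{(W^x_{0,n})^+}{n}=C_p(x),$$ where both limits hold almost surely and in $L^1$. Moreover, $C_p(x)>0$ and $C_p(x)\ge C_p(-\infty)$ for every real $x$. -/

import Mathlib

open MeasureTheory ProbabilityTheory Filter Topology

universe u

namespace WeightedBarakErdos

/-- The paths from `i` to `j` in the complete directed graph on `ℤ`: all finite strictly increasing
sequences of integers that start at `i` and end at `j`. -/
def paths (i j : ℤ) : Set (List ℤ) :=
  {π | π.IsChain (· < ·) ∧ π.head? = some i ∧ π.getLast? = some j}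

/-- The weight of a path: the sum of the weights `w a b` of its edges `(a, b)`, that is, of the
pairs of consecutive vertices. -/
def pathWeight {M : Type*} [Zero M] [Add M] (w : ℤ → ℤ → M) : List ℤ → M
  | [] => 0
  | [_] => 0
  | a :: b :: l => w a b + pathWeight w (b :: l)

/-- The maximum weight of all paths from `i` to `j`. For `i ≤ j` the supremum is a maximum, see
`isGreatest_maxWeight`. -/
noncomputable def maxWeight {M : Type*} [Zero M] [Add M] [SupSet M] (w : ℤ → ℤ → M) (i j : ℤ) : M :=
  sSup (pathWeight w '' paths i j)

lemma mem_Icc_of_mem_path {i j : ℤ} {π : List ℤ} (h : π ∈ paths i j) {a : ℤ} (ha : a ∈ π) :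
    a ∈ Finset.Icc i j := by
  obtain ⟨h1, h2, h3⟩ := h
  have hp := h1.pairwise
  rw [Finset.mem_Icc]
  constructor
  · cases π with
    | nil => simp at ha
    | cons b l =>
      simp only [List.head?_cons, Option.some.injEq] at h2
      subst h2
      rcases List.mem_cons.1 ha with rfl | h
      · exact le_rfl
      · exact ((List.pairwise_cons.1 hp).1 a h).le
  · obtain ⟨l, rfl⟩ := List.getLast?_eq_some_iff.1 h3
    rcases List.mem_append.1 ha with h | h
    · exact ((List.pairwise_append.1 hp).2.2 a h j (by simp)).le
    · simp at h
      exact h.le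

lemma finite_paths (i j : ℤ) : (paths i j).Finite := by
  refine Set.Finite.of_finite_image (f := List.toFinset)
    ((Finset.finite_toSet (Finset.Icc i j).powerset).subset ?_) ?_
  · rintro _ ⟨π, hπ, rfl⟩
    simp only [Finset.coe_powerset, Set.mem_preimage, Set.mem_powerset_iff, Finset.coe_subset]
    intro a ha
    exact mem_Icc_of_mem_path hπ (List.mem_toFinset.1 ha)
  · intro π hπ ρ hρ h
    have hp := hπ.1.pairwise
    have hr := hρ.1.pairwise
    have hperm : π.Perm ρ :=
      (List.perm_ext_iff_of_nodup (hp.imp fun h => h.ne) (hr.imp fun h => h.ne)).2 fun a => by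
        rw [← List.mem_toFinset, ← List.mem_toFinset]
        exact h ▸ Iff.rfl
    exact hperm.eq_of_pairwise (fun a b _ _ h1 h2 => absurd h1 h2.asymm) hp hr

lemma nonempty_paths {i j : ℤ} (h : i ≤ j) : (paths i j).Nonempty := by
  rcases h.eq_or_lt with rfl | h
  · exact ⟨[i], by simp [paths]⟩
  · exact ⟨[i, j], by simp [paths, h]⟩

lemma isGreatest_maxWeight {M : Type*} [Zero M] [Add M] [ConditionallyCompleteLinearOrder M]
    (w : ℤ → ℤ → M) {i j : ℤ} (h : i ≤ j) :
    IsGreatest (pathWeight w '' paths i j) (maxWeight w i j) :=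
  ⟨((nonempty_paths h).image _).csSup_mem ((finite_paths i j).image _),
    fun _ ha => le_csSup ((finite_paths i j).image _).bddAbove ha⟩

/-- The family `(α i j)`, `i < j`, is an i.i.d. family of random variables that take the value `1`
with probability `p` and `0` with probability `1 - p`. Nothing is required of `α i j` for
`i ≥ j`. -/
structure IsBernoulliEdgeFamily {Ω : Type*} [MeasurableSpace Ω] (P : Measure Ω) (p : ℝ)
    (α : ℤ → ℤ → Ω → ℝ) : Prop where
  measurable : ∀ i j, i < j → Measurable (α i j)
  indep : iIndepFun (fun e : {e : ℤ × ℤ // e.1 < e.2} => α e.1.1 e.1.2) P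
  prob_one : ∀ i j, i < j → P {ω | α i j ω = 1} = ENNReal.ofReal p
  prob_zero : ∀ i j, i < j → P {ω | α i j ω = 0} = ENNReal.ofReal (1 - p)

/-- The edge weight `α + x (1 - α)`, for real `x`. -/
def edgeWeight (x : ℝ) (a : ℤ → ℤ → ℝ) (i j : ℤ) : ℝ := a i j + x * (1 - a i j)

open Classical in
/-- The edge weight for `x = -∞`: it is `1` if `α = 1` and `-∞` otherwise. -/
noncomputable def edgeWeightBot (a : ℤ → ℤ → ℝ) (i j : ℤ) : EReal := if a i j = 1 then 1 else ⊥

/-- `W^x_{i,j}`, for real `x`. -/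
noncomputable def W {Ω : Type*} (α : ℤ → ℤ → Ω → ℝ) (x : ℝ) (i j : ℤ) (ω : Ω) : ℝ :=
  maxWeight (edgeWeight x fun k l => α k l ω) i j

/-- `W^{-∞}_{i,j}`, which is `-∞` if every path from `i` to `j` has an edge of weight `-∞`. -/
noncomputable def WBot {Ω : Type*} (α : ℤ → ℤ → Ω → ℝ) (i j : ℤ) (ω : Ω) : EReal :=
  maxWeight (edgeWeightBot fun k l => α k l ω) i j

/-- The positive part `(W^{-∞}_{i,j})^+`, a nonnegative real number. -/
noncomputable def WBotPos {Ω : Type*} (α : ℤ → ℤ → Ω → ℝ) (i j : ℤ) (ω : Ω) : ℝ :=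
  (max (WBot α i j ω) 0).toReal

/-- The random variables `X n` converge to the constant `c` almost surely. -/
def TendstoAS {Ω : Type*} [MeasurableSpace Ω] (P : Measure Ω) (X : ℕ → Ω → ℝ) (c : ℝ) : Prop :=
  ∀ᵐ ω ∂P, Tendsto (fun n => X n ω) atTop (𝓝 c)

/-- The random variables `X n` are integrable and converge to the constant `c` in `L¹`. -/
def TendstoL1 {Ω : Type*} [MeasurableSpace Ω] (P : Measure Ω) (X : ℕ → Ω → ℝ) (c : ℝ) : Prop :=
  (∀ n, Integrable (X n) P) ∧ Tendsto (fun n => ∫ ω, |X n ω - c| ∂P) atTop (𝓝 0)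

end WeightedBarakErdos

namespace WeightedBarakErdos

/-! For real `x`, concatenation makes the maximum weight superadditive. It is also subadditive up to
a constant, since an edge jumping over `m` can be replaced by two edges meeting at `m` at bounded
cost (`maxWeight_le_add`). Weights of blocks that share no edge are independent, so the strong law
applied to blocks of length `k` bounds the limsup of `F 0 n / n` by `(E F 0 k + D) / k`. As `k → ∞`
this becomes the limit of the normalised means, which exists by Fekete's lemma. Using this for `F`
and for `-F` gives almost sure convergence (`IsBlockFunctional.exists_ae_tendsto`), with no ergodic
theorem.

For `x = -∞` an absent edge cannot be replaced, and the path must end exactly at `0` and `n`. The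
comparison quantity is `longest`, where the endpoints are free; it is subadditive, so its means grow
like `c * n`, and it bounds the positive part from above. For the lower bound take `k` about `n ^
(1/4)` and blocks of length `k ^ 2` separated by gaps of length `k + 1`. By Borel–Cantelli, any two
vertices up to `(k + 1) ^ 4` at distance above `k` are eventually joined by two marked edges
(`ae_eventually_twoStep`), so the longest paths of the blocks can be chained from `0` to `n`.
Chebyshev's inequality and Borel–Cantelli keep the sum of their lengths near its mean
(`ae_eventually_sum_longest`). Finally `c ≥ p`, because a longest path in `[0, n)` extends to `n`
with probability at least `p` (`mul_le_integral_longest`).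

The limits are constructed under one product measure and carried to any Bernoulli family through its
law, so they depend on `p` and `x` only. Convergence in `L¹` follows by domination. -/

/-- `WPath w i j r`: there is a path from `i` to `j` of weight `r`. -/
inductive WPath {M : Type*} [Zero M] [Add M] (w : ℤ → ℤ → M) : ℤ → ℤ → M → Prop
  | nil (i : ℤ) : WPath w i i 0
  | cons {i j k : ℤ} {r : M} (h : i < j) (hp : WPath w j k r) : WPath w i k (w i j + r)

/-- `OnePath R i j n`: there is a path from `i` to `j` with `n` edges, all of them in `R`. -/
inductive OnePath (R : ℤ → ℤ → Prop) : ℤ → ℤ → ℕ → Prop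
  | nil (i : ℤ) : OnePath R i i 0
  | cons {i j k : ℤ} {n : ℕ} (h : i < j) (hR : R i j) (hp : OnePath R j k n) :
      OnePath R i k (n + 1)

/-! ### Weighted paths: translation, concatenation, cutting -/

section WPath

variable {M : Type*} [Zero M] [Add M] {w : ℤ → ℤ → M}

/-- Trades lists for an inductive relation, so that later arguments are inductions on the first
edge. -/
lemma wPath_iff {i j : ℤ} {r : M} : WPath w i j r ↔ r ∈ pathWeight w '' paths i j := by
  constructor
  · intro h
    induction h with
    | nil i => exact ⟨[i], by simp [paths], rfl⟩
    | @cons i j k r h hp ih =>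
      obtain ⟨π, ⟨h1, h2, h3⟩, rfl⟩ := ih
      cases π with
      | nil => simp at h2
      | cons b l =>
        simp only [List.head?_cons, Option.some.injEq] at h2
        subst h2
        refine ⟨i :: b :: l, ⟨?_, rfl, ?_⟩, rfl⟩
        · exact List.isChain_cons_cons.2 ⟨h, h1⟩
        · rw [List.getLast?_cons_cons]
          exact h3
  · rintro ⟨π, ⟨h1, h2, h3⟩, rfl⟩
    induction π generalizing i with
    | nil => simp at h2
    | cons b l ih =>
      simp only [List.head?_cons, Option.some.injEq] at h2
      subst h2
      cases l with
      | nil =>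
        simp only [List.getLast?_singleton, Option.some.injEq] at h3
        subst h3
        exact WPath.nil _
      | cons c l =>
        rw [List.isChain_cons_cons] at h1
        rw [List.getLast?_cons_cons] at h3
        exact WPath.cons h1.1 (ih h1.2 rfl h3)

lemma WPath.le {i j : ℤ} {r : M} (h : WPath w i j r) : i ≤ j := by
  induction h with
  | nil => exact le_rfl
  | cons h _ ih => exact h.le.trans ih

lemma WPath.map {w' : ℤ → ℤ → M} {i j m : ℤ} {r : M} (h : WPath w i j r)
    (hw : ∀ a b, i ≤ a → a < b → b ≤ j → w' (a + m) (b + m) = w a b) :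
    WPath w' (i + m) (j + m) r := by
  induction h with
  | nil => exact WPath.nil _
  | @cons i j k r h hp ih =>
    rw [← hw i j le_rfl h hp.le]
    exact WPath.cons (by lia) (ih fun a b ha hab hb => hw a b (h.le.trans ha) hab hb)

lemma maxWeight_map [SupSet M] {w' : ℤ → ℤ → M} {i j : ℤ} (m : ℤ)
    (hw : ∀ a b, i ≤ a → a < b → b ≤ j → w' (a + m) (b + m) = w a b) :
    maxWeight w' (i + m) (j + m) = maxWeight w i j := by
  unfold maxWeight
  congr 1
  ext r
  rw [← wPath_iff, ← wPath_iff]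
  refine ⟨fun h => ?_, fun h => h.map hw⟩
  have h2 : WPath w (i + m + -m) (j + m + -m) r := h.map fun a b ha hab hb => by
    rw [← hw (a + -m) (b + -m) (by lia) (by lia) (by lia)]
    simp
  simpa using h2

lemma maxWeight_congr [SupSet M] {w' : ℤ → ℤ → M} {i j : ℤ}
    (hw : ∀ a b, i ≤ a → a < b → b ≤ j → w' a b = w a b) :
    maxWeight w' i j = maxWeight w i j := by
  simpa using maxWeight_map (w := w) (w' := w') (i := i) (j := j) 0 (by simpa using hw)

end WPath

lemma WPath.le_maxWeight {M : Type*} [Zero M] [Add M] [ConditionallyCompleteLinearOrder M]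
    {w : ℤ → ℤ → M} {i j : ℤ} {r : M} (h : WPath w i j r) : r ≤ maxWeight w i j :=
  (isGreatest_maxWeight w h.le).2 (wPath_iff.1 h)

lemma wPath_maxWeight {M : Type*} [Zero M] [Add M] [ConditionallyCompleteLinearOrder M]
    (w : ℤ → ℤ → M) {i j : ℤ} (h : i ≤ j) : WPath w i j (maxWeight w i j) :=
  wPath_iff.2 (isGreatest_maxWeight w h).1

section Real

variable {w : ℤ → ℤ → ℝ}

lemma WPath.trans {i j k : ℤ} {r s : ℝ} (h : WPath w i j r) (h' : WPath w j k s) :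
    WPath w i k (r + s) := by
  induction h with
  | nil => simpa using h'
  | cons h _ ih =>
    rw [add_assoc]
    exact WPath.cons h (ih h')

/-- At most one edge jumps over `m`, so the cost `D` of rerouting it through `m` is paid at most
once; `D ≥ 0` covers the paths that visit `m`. -/
lemma WPath.split {D : ℝ} (hD : 0 ≤ D)
    (hw : ∀ i m j, i < m → m < j → w i j ≤ w i m + w m j + D) {i k m : ℤ} {r : ℝ}
    (h : WPath w i k r) (him : i ≤ m) (hmk : m ≤ k) :
    ∃ r₁ r₂, WPath w i m r₁ ∧ WPath w m k r₂ ∧ r ≤ r₁ + r₂ + D := by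
  induction h with
  | nil i =>
    obtain rfl := le_antisymm him hmk
    exact ⟨0, 0, WPath.nil _, WPath.nil _, by simpa using hD⟩
  | @cons i j k r h hp ih =>
    rcases him.eq_or_lt with rfl | him
    · exact ⟨0, _, WPath.nil _, WPath.cons h hp, by linarith⟩
    rcases le_or_gt j m with hjm | hmj
    · obtain ⟨r₁, r₂, h1, h2, h3⟩ := ih hjm hmk
      exact ⟨_, r₂, WPath.cons h h1, h2, by linarith⟩
    · exact ⟨_, _, WPath.cons him (WPath.nil _), WPath.cons hmj hp, by
        linarith [hw i m j him hmj]⟩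

lemma WPath.abs_le {B : ℝ} (hw : ∀ i j, i < j → |w i j| ≤ B) {i j : ℤ} {r : ℝ}
    (h : WPath w i j r) : |r| ≤ B * (j - i) := by
  induction h with
  | nil => simp
  | @cons i j k r h hp ih =>
    have h1 := hw i j h
    have hB : 0 ≤ B := (abs_nonneg _).trans h1
    have h2 : (i : ℝ) + 1 ≤ j := by exact_mod_cast h
    calc |w i j + r| ≤ |w i j| + |r| := abs_add_le _ _
      _ ≤ B * 1 + B * (k - j) := by linarith
      _ ≤ B * (k - i) := by nlinarith

lemma maxWeight_add_le {i m k : ℤ} (him : i ≤ m) (hmk : m ≤ k) :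
    maxWeight w i m + maxWeight w m k ≤ maxWeight w i k :=
  ((wPath_maxWeight w him).trans (wPath_maxWeight w hmk)).le_maxWeight

lemma maxWeight_le_add {D : ℝ} (hD : 0 ≤ D)
    (hw : ∀ i m j, i < m → m < j → w i j ≤ w i m + w m j + D) {i m k : ℤ} (him : i ≤ m)
    (hmk : m ≤ k) : maxWeight w i k ≤ maxWeight w i m + maxWeight w m k + D := by
  obtain ⟨r₁, r₂, h1, h2, h3⟩ := (wPath_maxWeight w (him.trans hmk)).split hD hw him hmk
  linarith [h1.le_maxWeight, h2.le_maxWeight]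

lemma abs_maxWeight_le {B : ℝ} (hw : ∀ i j, i < j → |w i j| ≤ B) {i j : ℤ} (h : i ≤ j) :
    |maxWeight w i j| ≤ B * (j - i) :=
  (wPath_maxWeight w h).abs_le hw

end Real

/-! ### Paths of marked edges and longest paths in intervals -/

section OnePath

variable {R : ℤ → ℤ → Prop}

lemma OnePath.add_le {i j : ℤ} {n : ℕ} (h : OnePath R i j n) : i + n ≤ j := by
  induction h with
  | nil => simp
  | cons h _ _ ih => push_cast; lia

lemma OnePath.le {i j : ℤ} {n : ℕ} (h : OnePath R i j n) : i ≤ j := by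
  have := h.add_le
  lia

lemma OnePath.trans {i j k : ℤ} {m n : ℕ} (h : OnePath R i j m) (h' : OnePath R j k n) :
    OnePath R i k (m + n) := by
  induction h with
  | nil => simpa using h'
  | cons h hR _ ih =>
    rw [add_right_comm]
    exact OnePath.cons h hR (ih h')

lemma OnePath.map {R' : ℤ → ℤ → Prop} {i j m : ℤ} {n : ℕ} (h : OnePath R i j n)
    (hR : ∀ a b, i ≤ a → a < b → b ≤ j → R a b → R' (a + m) (b + m)) :
    OnePath R' (i + m) (j + m) n := by
  induction h with
  | nil => exact OnePath.nil _
  | @cons i j k n h h' hp ih =>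
    exact OnePath.cons (by lia) (hR i j le_rfl h hp.le h')
      (ih fun a b ha hab hb => hR a b (h.le.trans ha) hab hb)

lemma OnePath.split {i k : ℤ} {n : ℕ} (h : OnePath R i k n) (m : ℤ) (him : i < m) (hmk : m ≤ k) :
    ∃ a b n₁ n₂, a < m ∧ m ≤ b ∧ OnePath R i a n₁ ∧ OnePath R b k n₂ ∧ n = n₁ + n₂ + 1 := by
  induction h with
  | nil i => exact absurd hmk him.not_ge
  | @cons i j k n h hR hp ih =>
    rcases lt_or_ge j m with hjm | hmj
    · obtain ⟨a, b, n₁, n₂, h1, h2, h3, h4, h5⟩ := ih hjm hmk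
      exact ⟨a, b, n₁ + 1, n₂, h1, h2, OnePath.cons h hR h3, h4, by lia⟩
    · exact ⟨i, j, 0, n, him, hmj, OnePath.nil _, hp, by lia⟩

variable (R) in
/-- The largest number of vertices of a path in `[a, b)` all of whose edges are in `R`. -/
noncomputable def longest (a b : ℤ) : ℕ :=
  sSup {n | ∃ i j m, a ≤ i ∧ j < b ∧ OnePath R i j m ∧ n = m + 1}

lemma le_of_mem_longest {a b : ℤ} :
    ∀ n ∈ {n | ∃ i j m, a ≤ i ∧ j < b ∧ OnePath R i j m ∧ n = m + 1}, n ≤ (b - a).toNat := by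
  rintro n ⟨i, j, m, h1, h2, h3, rfl⟩
  have := h3.add_le
  lia

lemma bddAbove_longest {a b : ℤ} :
    BddAbove {n | ∃ i j m, a ≤ i ∧ j < b ∧ OnePath R i j m ∧ n = m + 1} :=
  ⟨_, le_of_mem_longest⟩

lemma OnePath.succ_le_longest {a b i j : ℤ} {m : ℕ} (h : OnePath R i j m) (hi : a ≤ i)
    (hj : j < b) : m + 1 ≤ longest R a b :=
  le_csSup bddAbove_longest ⟨i, j, m, hi, hj, h, rfl⟩

lemma exists_longest {a b : ℤ} (h : a < b) :
    ∃ i j m, a ≤ i ∧ j < b ∧ OnePath R i j m ∧ longest R a b = m + 1 :=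
  Nat.sSup_mem (s := {n | ∃ i j m, a ≤ i ∧ j < b ∧ OnePath R i j m ∧ n = m + 1})
    ⟨1, a, a, 0, le_rfl, h, OnePath.nil _, rfl⟩ bddAbove_longest

lemma longest_le (a b : ℤ) : longest R a b ≤ (b - a).toNat := by
  rcases lt_or_ge a b with h | h
  · exact csSup_le' le_of_mem_longest
  · exact csSup_le' le_of_mem_longest

lemma longest_self (a : ℤ) : longest R a a = 0 := by
  simpa using longest_le (R := R) a a

/-- Counting vertices instead of edges makes this exact: cutting at `m` destroys an edge but no
vertex. -/
lemma longest_le_add (a m b : ℤ) : longest R a b ≤ longest R a m + longest R m b := by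
  refine csSup_le' ?_
  rintro _ ⟨i, j, n, h1, h2, h3, rfl⟩
  rcases lt_or_ge j m with hj | hj
  · have := h3.succ_le_longest h1 hj
    lia
  rcases lt_or_ge i m with hi | hi
  · obtain ⟨c, d, n₁, n₂, hc, hd, h4, h5, rfl⟩ := h3.split m hi hj
    have h6 := h4.succ_le_longest h1 hc
    have h7 := h5.succ_le_longest hd h2
    lia
  · have := h3.succ_le_longest hi h2
    lia

lemma longest_map_le {R' : ℤ → ℤ → Prop} {a b : ℤ} (m : ℤ)
    (hR : ∀ i j, a ≤ i → i < j → j < b → R i j → R' (i + m) (j + m)) :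
    longest R a b ≤ longest R' (a + m) (b + m) := by
  refine csSup_le' ?_
  rintro _ ⟨i, j, n, h1, h2, h3, rfl⟩
  exact (h3.map fun c d hc hcd hd => hR c d (h1.trans hc) hcd (hd.trans_lt h2)).succ_le_longest
    (by lia) (by lia)

lemma longest_map {R' : ℤ → ℤ → Prop} {a b : ℤ} (m : ℤ)
    (hR : ∀ i j, a ≤ i → i < j → j < b → (R' (i + m) (j + m) ↔ R i j)) :
    longest R' (a + m) (b + m) = longest R a b := by
  refine le_antisymm ?_ (longest_map_le m fun i j h1 h2 h3 => (hR i j h1 h2 h3).2)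
  have := longest_map_le (R := R') (R' := R) (a := a + m) (b := b + m) (-m)
    fun i j h1 h2 h3 h => by
      refine (hR (i + -m) (j + -m) (by lia) (by lia) (by lia)).1 ?_
      simpa using h
  simpa using this

lemma longest_congr {R' : ℤ → ℤ → Prop} {a b : ℤ}
    (hR : ∀ i j, a ≤ i → i < j → j < b → (R' i j ↔ R i j)) :
    longest R' a b = longest R a b := by
  simpa using longest_map (R := R) (R' := R') (a := a) (b := b) 0 (by simpa using hR)

/-- `a` and `b` are joined by a path with two edges in `R`. -/
def TwoStep (R : ℤ → ℤ → Prop) (a b : ℤ) : Prop := ∃ x, a < x ∧ x < b ∧ R a x ∧ R x b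

lemma TwoStep.onePath {a b : ℤ} (h : TwoStep R a b) : OnePath R a b 2 := by
  obtain ⟨x, h1, h2, h3, h4⟩ := h
  exact OnePath.cons h1 h3 (OnePath.cons h2 h4 (OnePath.nil _))

/-- If any two vertices of `[0, N]` at distance at least `s` are joined by two edges, then the
longest paths of blocks that are separated by gaps of length `s` can be joined. -/
lemma exists_onePath_blocks {K s N : ℕ} (hsK : s < K)
    (hA : ∀ a b : ℤ, 0 ≤ a → a + s ≤ b → b ≤ N → TwoStep R a b) (m : ℕ) (hm : m * K ≤ N) :
    ∃ (b : ℤ) (e : ℕ), b ≤ m * K ∧ OnePath R 0 b e ∧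
      ∑ j ∈ Finset.range m, longest R (j * K + s) ((j + 1) * K) ≤ e := by
  induction m with
  | zero => exact ⟨0, 0, by simp, OnePath.nil _, by simp⟩
  | succ m ih =>
    obtain ⟨b, e, hb, hp, hs⟩ := ih (le_trans (by gcongr; lia) hm)
    have h1 : (m * K + s : ℤ) < (m + 1) * K := by
      have : (s : ℤ) < K := by exact_mod_cast hsK
      linarith
    have h2 : ((m + 1) * K : ℤ) ≤ N := by exact_mod_cast hm
    obtain ⟨c, d, n, hc, hd, hcd, hn⟩ := exists_longest (R := R) h1
    have h3 := hcd.le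
    have h4 := hA b c hp.le (by linarith) (by linarith)
    -- The new block contributes `n + 1` vertices but only `n` edges; the two linking edges more
    -- than make up for this.
    refine ⟨d, e + 2 + n, by push_cast; exact hd.le, (hp.trans h4.onePath).trans hcd, ?_⟩
    rw [Finset.sum_range_succ, hn]
    lia

lemma exists_onePath_of_twoStep {K s N : ℕ} (hsK : s < K)
    (hA : ∀ a b : ℤ, 0 ≤ a → a + s ≤ b → b ≤ N → TwoStep R a b) {m n : ℕ} (hm : m * K + s ≤ n)
    (hn : n ≤ N) : ∃ e : ℕ, OnePath R 0 n e ∧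
      ∑ j ∈ Finset.range m, longest R (j * K + s) ((j + 1) * K) ≤ e := by
  obtain ⟨b, e, hb, hp, hs⟩ := exists_onePath_blocks hsK hA m (by lia)
  have h1 : (m * K + s : ℤ) ≤ n := by exact_mod_cast hm
  have h2 := hA b n hp.le (by linarith) (by exact_mod_cast hn)
  exact ⟨e + 2, hp.trans h2.onePath, by lia⟩

end OnePath

/-! ### The weights for `x = -∞` -/

section Bot

variable {a : ℤ → ℤ → ℝ}

lemma OnePath.wPath_edgeWeight {i j : ℤ} {n : ℕ} (x : ℝ)
    (h : OnePath (fun k l => a k l = 1) i j n) : WPath (edgeWeight x a) i j n := by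
  induction h with
  | nil => simpa using WPath.nil _
  | @cons i j k n h hR _ ih =>
    have h1 := WPath.cons h ih
    have h2 : edgeWeight x a i j = 1 := by simp [edgeWeight, hR]
    rw [h2, add_comm] at h1
    exact_mod_cast h1

lemma OnePath.wPath_edgeWeightBot {i j : ℤ} {n : ℕ}
    (h : OnePath (fun k l => a k l = 1) i j n) :
    WPath (edgeWeightBot a) i j ((n : ℝ) : EReal) := by
  induction h with
  | nil => simpa using WPath.nil _
  | @cons i j k n h hR _ ih =>
    have h1 := WPath.cons h ih
    have h2 : edgeWeightBot a i j = 1 := by simp [edgeWeightBot, hR]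
    rw [h2, add_comm] at h1
    exact_mod_cast h1

/-- Adding `⊥` in `EReal` always gives `⊥`, so a single unmarked edge spoils the whole path. -/
lemma WPath.exists_onePath {i j : ℤ} {r : EReal} (h : WPath (edgeWeightBot a) i j r)
    (hr : r ≠ ⊥) : ∃ n : ℕ, OnePath (fun k l => a k l = 1) i j n ∧ r = ((n : ℝ) : EReal) := by
  induction h with
  | nil i => exact ⟨0, OnePath.nil _, by simp⟩
  | @cons i j k r h hp ih =>
    by_cases ha : a i j = 1
    · have h2 : edgeWeightBot a i j = 1 := by simp [edgeWeightBot, ha]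
      have hr' : r ≠ ⊥ := by
        rintro rfl
        simp at hr
      obtain ⟨n, hn, rfl⟩ := ih hr'
      refine ⟨n + 1, OnePath.cons h ha hn, ?_⟩
      rw [h2, add_comm]
      push_cast
      rfl
    · have h2 : edgeWeightBot a i j = ⊥ := by simp [edgeWeightBot, ha]
      simp [h2] at hr

/-- The positive part of the maximum weight for `x = -∞`. -/
noncomputable def posMaxBot (a : ℤ → ℤ → ℝ) (i j : ℤ) : ℝ :=
  (max (maxWeight (edgeWeightBot a) i j) 0).toReal

lemma OnePath.le_posMaxBot {i j : ℤ} {n : ℕ} (h : OnePath (fun k l => a k l = 1) i j n) :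
    (n : ℝ) ≤ posMaxBot a i j := by
  have h1 := h.wPath_edgeWeightBot.le_maxWeight
  obtain ⟨m, -, hm⟩ := (wPath_maxWeight (edgeWeightBot a) h.le).exists_onePath
    (ne_of_gt ((EReal.bot_lt_coe _).trans_le h1))
  rw [hm] at h1
  have h0 : (0 : EReal) ≤ ((m : ℝ) : EReal) := by exact_mod_cast m.cast_nonneg
  rw [posMaxBot, hm, max_eq_left h0, EReal.toReal_coe]
  exact_mod_cast h1

lemma exists_onePath_posMaxBot {i j : ℤ} (h : i ≤ j) (hp : posMaxBot a i j ≠ 0) :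
    ∃ n : ℕ, OnePath (fun k l => a k l = 1) i j n ∧ posMaxBot a i j = n := by
  by_cases hb : maxWeight (edgeWeightBot a) i j = ⊥
  · simp [posMaxBot, hb] at hp
  obtain ⟨m, h1, hm⟩ := (wPath_maxWeight (edgeWeightBot a) h).exists_onePath hb
  have h0 : (0 : EReal) ≤ ((m : ℝ) : EReal) := by exact_mod_cast m.cast_nonneg
  exact ⟨m, h1, by rw [posMaxBot, hm, max_eq_left h0, EReal.toReal_coe]⟩

lemma posMaxBot_le_longest {i j : ℤ} (h : i ≤ j) :
    posMaxBot a i j ≤ longest (fun k l => a k l = 1) i (j + 1) := by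
  by_cases hp : posMaxBot a i j = 0
  · rw [hp]
    exact Nat.cast_nonneg _
  obtain ⟨n, h1, h2⟩ := exists_onePath_posMaxBot h hp
  rw [h2]
  have := h1.succ_le_longest le_rfl (lt_add_one j)
  exact_mod_cast (by lia : n ≤ _)

/-- A nonzero positive part is attained by a path of marked edges, whose weight does not depend on
`x`. Without `hp` this could fail for negative `x`. -/
lemma posMaxBot_le_maxWeight {i j : ℤ} (h : i ≤ j) (hp : posMaxBot a i j ≠ 0) (x : ℝ) :
    posMaxBot a i j ≤ maxWeight (edgeWeight x a) i j := by
  obtain ⟨n, h1, h2⟩ := exists_onePath_posMaxBot h hp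
  rw [h2]
  exact (h1.wPath_edgeWeight x).le_maxWeight

lemma posMaxBot_congr {a' : ℤ → ℤ → ℝ} (h : ∀ k l, k < l → a' k l = a k l) (i j : ℤ) :
    posMaxBot a' i j = posMaxBot a i j := by
  rw [posMaxBot, posMaxBot, maxWeight_congr fun k l _ hkl _ => ?_]
  simp [edgeWeightBot, h k l hkl]

end Bot

lemma abs_edgeWeight_le (x : ℝ) {a : ℤ → ℤ → ℝ} {i j : ℤ} (ha : a i j = 0 ∨ a i j = 1) :
    |edgeWeight x a i j| ≤ max 1 |x| := by
  rcases ha with h | h <;> simp [edgeWeight, h]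

/-! ### The canonical probability space of marks -/

/-- The edges of the complete directed graph on `ℤ`. -/
abbrev Edge : Type := {e : ℤ × ℤ // e.1 < e.2}

/-- The configurations of marks on the edges. -/
abbrev Config : Type := Edge → Bool

/-- The Bernoulli measure on `Bool`. -/
noncomputable def bern (p : unitInterval) : Measure Bool :=
  ENNReal.ofReal p • Measure.dirac true + ENNReal.ofReal (1 - p) • Measure.dirac false

instance (p : unitInterval) : IsProbabilityMeasure (bern p) := by
  constructor
  simp only [bern, Measure.coe_add, Measure.coe_smul, Pi.add_apply, Pi.smul_apply,
    measure_univ, smul_eq_mul, mul_one]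
  rw [← ENNReal.ofReal_add p.2.1 (by linarith [p.2.2])]
  simp

/-- The law of i.i.d. Bernoulli marks on the edges. -/
noncomputable def configMeasure (p : unitInterval) : Measure Config :=
  Measure.infinitePi fun _ => bern p

instance (p : unitInterval) : IsProbabilityMeasure (configMeasure p) := by
  unfold configMeasure
  infer_instance

lemma measurable_of_dependsOn {ι β : Type*} [MeasurableSpace β] {f : (ι → Bool) → β} {s : Set ι}
    (hf : DependsOn f s) (hs : s.Finite) : Measurable f := by
  have : Finite s := hs
  -- The factorisation needs `β` nonempty, which a value of `f` witnesses. The factor lives on a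
  -- finite space, where every function is measurable.
  obtain ⟨h, rfl⟩ := (@dependsOn_iff_exists_comp ι (fun _ => Bool) β ⟨f fun _ => true⟩ f s).1 hf
  exact (measurable_of_finite h).comp (measurable_pi_lambda _ fun i => measurable_pi_apply _)

lemma indepFun_of_dependsOn (p : unitInterval) {β γ : Type*} [MeasurableSpace β]
    [MeasurableSpace γ] {f : Config → β} {g : Config → γ} {s t : Set Edge}
    (hf : DependsOn f s) (hg : DependsOn g t) (hs : s.Finite) (ht : t.Finite)
    (hst : Disjoint s t) : IndepFun f g (configMeasure p) := by
  classical
  lift s to Finset Edge using hs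
  lift t to Finset Edge using ht
  rw [Finset.disjoint_coe] at hst
  have hind : iIndepFun (fun (e : Edge) (ω : Config) => ω e) (configMeasure p) :=
    iIndepFun_infinitePi (P := fun _ : Edge => bern p) (X := fun _ b => b) fun _ => measurable_id
  have h := hind.indepFun_finset s t hst fun e => measurable_pi_apply e
  obtain ⟨f', rfl⟩ := (@dependsOn_iff_exists_comp _ (fun _ => Bool) β ⟨f fun _ => true⟩ f s).1 hf
  obtain ⟨g', rfl⟩ := (@dependsOn_iff_exists_comp _ (fun _ => Bool) γ ⟨g fun _ => true⟩ g t).1 hg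
  exact h.comp (φ := f') (ψ := g') (measurable_of_finite f') (measurable_of_finite g')

/-- An i.i.d. family of Bernoulli marks has the law `configMeasure p`. -/
lemma map_eq_configMeasure {Ω : Type*} [MeasurableSpace Ω] {P : Measure Ω}
    [IsProbabilityMeasure P] (p : unitInterval) {X : Edge → Ω → Bool}
    (hX : ∀ e, Measurable (X e)) (hind : iIndepFun X P) (hlaw : ∀ e, P.map (X e) = bern p) :
    P.map (fun ω e => X e ω) = configMeasure p := by
  rw [(iIndepFun_iff_map_fun_eq_infinitePi_map hX).1 hind, configMeasure]
  simp_rw [hlaw]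

/-- The translation of a configuration by `m`. -/
def shift (m : ℤ) (g : Config) : Config := fun e => g ⟨(e.1.1 + m, e.1.2 + m), by
  simpa using e.2⟩

lemma measurePreserving_shift (p : unitInterval) (m : ℤ) :
    MeasurePreserving (shift m) (configMeasure p) (configMeasure p) := by
  refine ⟨measurable_pi_lambda _ fun e => measurable_pi_apply _,
    Measure.map_infinitePi_infinitePi_of_inj (P := fun _ : Edge => bern p) (f := fun e : Edge =>
      (⟨(e.1.1 + m, e.1.2 + m), by simpa using e.2⟩ : Edge)) fun e e' h => ?_⟩
  simp only [Subtype.mk.injEq, Prod.mk.injEq, add_left_inj] at h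
  exact Subtype.ext (Prod.ext h.1 h.2)

/-- The edges with mark `true`. -/
def rel (g : Config) (i j : ℤ) : Prop := ∃ h : i < j, g ⟨(i, j), h⟩ = true

lemma rel_shift (m : ℤ) (g : Config) (i j : ℤ) : rel (shift m g) i j ↔ rel g (i + m) (j + m) := by
  simp [rel, shift]

/-- The edges with both ends in `[a, b]`. -/
def edgesIn (a b : ℤ) : Set Edge := {e | a ≤ e.1.1 ∧ e.1.2 ≤ b}

lemma finite_edgesIn (a b : ℤ) : (edgesIn a b).Finite := by
  refine Set.Finite.of_finite_image (f := Subtype.val)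
    ((Finset.finite_toSet (Finset.Icc a b ×ˢ Finset.Icc a b)).subset ?_)
    Subtype.val_injective.injOn
  rintro _ ⟨e, ⟨h1, h2⟩, rfl⟩
  have := e.2
  simp only [Finset.coe_product, Finset.coe_Icc, Set.mem_prod, Set.mem_Icc]
  lia

/-- Adjacent intervals may share a vertex but no edge, so consecutive blocks need no gap to be
independent. -/
lemma disjoint_edgesIn {a b c d : ℤ} (h : b ≤ c) : Disjoint (edgesIn a b) (edgesIn c d) := by
  rw [Set.disjoint_left]
  rintro e ⟨_, h1⟩ ⟨h2, _⟩
  have := e.2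
  lia

lemma rel_congr {a b : ℤ} {g g' : Config} (h : ∀ e ∈ edgesIn a b, g e = g' e) {i j : ℤ}
    (hi : a ≤ i) (hj : j ≤ b) : rel g i j ↔ rel g' i j := by
  unfold rel
  refine exists_congr fun hij => ?_
  rw [h ⟨(i, j), hij⟩ ⟨hi, hj⟩]

open Classical in
/-- The mark of the edge `(i, j)`, as a real number. -/
noncomputable def mark (i j : ℤ) (g : Config) : ℝ := if rel g i j then 1 else 0

lemma mark_eq_one_iff {i j : ℤ} {g : Config} : mark i j g = 1 ↔ rel g i j := by
  simp [mark]

lemma mark_zero_or_one (i j : ℤ) (g : Config) : mark i j g = 0 ∨ mark i j g = 1 := by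
  unfold mark
  split_ifs <;> simp

lemma dependsOn_mark {i j : ℤ} (h : i < j) : DependsOn (mark i j) {⟨(i, j), h⟩} := by
  intro g g' hg
  have h1 : rel g i j ↔ rel g' i j := exists_congr fun hij => by rw [hg ⟨(i, j), hij⟩ rfl]
  unfold mark
  split_ifs <;> tauto

lemma integral_mark (p : unitInterval) {i j : ℤ} (h : i < j) :
    ∫ g, mark i j g ∂configMeasure p = p := by
  have h1 : mark i j = (fun b : Bool => if b then (1 : ℝ) else 0) ∘
      fun g : Config => g ⟨(i, j), h⟩ := by
    ext g
    simp [mark, rel, h]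
  have h2 : (configMeasure p).map (fun g : Config => g ⟨(i, j), h⟩) = bern p :=
    Measure.infinitePi_map_eval (fun _ : Edge => bern p) ⟨(i, j), h⟩
  have h3 := integral_map (μ := configMeasure p) (φ := fun g : Config => g ⟨(i, j), h⟩)
    (measurable_pi_apply _).aemeasurable
    (measurable_of_finite fun b : Bool => if b then (1 : ℝ) else 0).aestronglyMeasurable
  rw [h1]
  refine h3.symm.trans ?_
  have : IsFiniteMeasure (ENNReal.ofReal p • Measure.dirac true) :=
    Measure.smul_finite _ ENNReal.ofReal_ne_top
  have : IsFiniteMeasure (ENNReal.ofReal (1 - p) • Measure.dirac false) :=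
    Measure.smul_finite _ ENNReal.ofReal_ne_top
  rw [h2, bern, integral_add_measure (Integrable.of_finite) (Integrable.of_finite)]
  simp [p.2.1]

/-! ### Law of large numbers for block functionals -/

/-- A stationary family of bounded functionals of the marks of the edges in an interval. -/
structure IsBlockFunctional (F : ℤ → ℤ → Config → ℝ) (B : ℝ) : Prop where
  dependsOn : ∀ i j, DependsOn (F i j) (edgesIn i j)
  shift : ∀ i j m g, F (i + m) (j + m) g = F i j (shift m g)
  abs_le : ∀ i j, i ≤ j → ∀ g, |F i j g| ≤ B * (j - i)

namespace IsBlockFunctional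

variable {F : ℤ → ℤ → Config → ℝ} {B : ℝ}

lemma neg (hF : IsBlockFunctional F B) : IsBlockFunctional (fun i j g => -F i j g) B where
  dependsOn i j _ _ h := congrArg Neg.neg (hF.dependsOn i j h)
  shift i j m g := by rw [hF.shift]
  abs_le i j h g := by rw [abs_neg]; exact hF.abs_le i j h g

lemma measurable (hF : IsBlockFunctional F B) (i j : ℤ) : Measurable (F i j) :=
  measurable_of_dependsOn (hF.dependsOn i j) (finite_edgesIn i j)

lemma memLp (hF : IsBlockFunctional F B) (p : unitInterval) {i j : ℤ} (h : i ≤ j)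
    (q : ENNReal) : MemLp (F i j) q (configMeasure p) :=
  MemLp.of_bound (hF.measurable i j).aestronglyMeasurable _
    (ae_of_all _ fun g => hF.abs_le i j h g)

lemma integrable (hF : IsBlockFunctional F B) (p : unitInterval) {i j : ℤ} (h : i ≤ j) :
    Integrable (F i j) (configMeasure p) :=
  memLp_one_iff_integrable.1 (hF.memLp p h 1)

lemma identDistrib (hF : IsBlockFunctional F B) (p : unitInterval) (i j m : ℤ) :
    IdentDistrib (F (i + m) (j + m)) (F i j) (configMeasure p) (configMeasure p) := by
  refine ⟨(hF.measurable _ _).aemeasurable, (hF.measurable _ _).aemeasurable, ?_⟩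
  have h1 : F (i + m) (j + m) = F i j ∘ WeightedBarakErdos.shift m := by
    ext g
    exact hF.shift i j m g
  rw [h1, ← Measure.map_map (hF.measurable i j) (measurePreserving_shift p m).measurable,
    (measurePreserving_shift p m).map_eq]

lemma integral_add (hF : IsBlockFunctional F B) (p : unitInterval) (i j m : ℤ) :
    ∫ g, F (i + m) (j + m) g ∂configMeasure p = ∫ g, F i j g ∂configMeasure p :=
  (hF.identDistrib p i j m).integral_eq

lemma indepFun (hF : IsBlockFunctional F B) (p : unitInterval) {i j k l : ℤ} (h : j ≤ k) :
    IndepFun (F i j) (F k l) (configMeasure p) :=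
  indepFun_of_dependsOn p (hF.dependsOn i j) (hF.dependsOn k l) (finite_edgesIn _ _)
    (finite_edgesIn _ _) (disjoint_edgesIn h)

/-- The functional, applied to consecutive blocks of length `k`, with a gap of length `s`, gives
pairwise independent random variables. -/
lemma pairwise_indepFun (hF : IsBlockFunctional F B) (p : unitInterval) (k s : ℕ) :
    Pairwise fun i j : ℕ => IndepFun (F (i * k + s) ((i + 1) * k)) (F (j * k + s) ((j + 1) * k))
      (configMeasure p) := by
  have h : ∀ i j : ℕ, i < j → IndepFun (F (i * k + s) ((i + 1) * k))
      (F (j * k + s) ((j + 1) * k)) (configMeasure p) := fun i j hij => by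
    refine hF.indepFun p ?_
    have : ((i + 1 : ℕ) * k : ℤ) ≤ j * k := by
      gcongr
      exact hij
    push_cast at this
    lia
  intro i j hij
  rcases hij.lt_or_gt with h1 | h1
  · exact h i j h1
  · exact (h j i h1).symm

lemma ae_tendsto_blocks (hF : IsBlockFunctional F B) (p : unitInterval) (k : ℕ) :
    ∀ᵐ g ∂configMeasure p, Tendsto
      (fun m : ℕ => (∑ j ∈ Finset.range m, F (j * k) ((j + 1) * k) g) / m) atTop
      (𝓝 (∫ g, F 0 k g ∂configMeasure p)) := by
  have h := strong_law_ae_real (μ := configMeasure p)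
    (fun j : ℕ => F (j * k) ((j + 1) * k)) ?_ ?_ ?_
  · simpa using h
  · exact hF.integrable p (by simp)
  · have := hF.pairwise_indepFun p k 0
    simp only [Nat.cast_zero, add_zero] at this
    exact this
  · intro j
    have := hF.identDistrib p 0 k (j * k)
    simpa [add_mul, add_comm] using this

lemma le_sum_blocks (hF : IsBlockFunctional F B) {D : ℝ}
    (hD : ∀ i m k, i ≤ m → m ≤ k → ∀ g, F i k g ≤ F i m g + F m k g + D) (k q : ℕ) (g : Config) :
    F 0 (q * k) g ≤ ∑ j ∈ Finset.range q, F (j * k) ((j + 1) * k) g + q * D := by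
  induction q with
  | zero => simpa using le_of_abs_le (hF.abs_le 0 0 le_rfl g)
  | succ q ih =>
    have h1 : (q * k : ℤ) ≤ (q + 1) * k := by
      gcongr
      lia
    have h2 := hD 0 (q * k) ((q + 1) * k) (by positivity) h1 g
    rw [Finset.sum_range_succ]
    push_cast
    linarith

/-- Write `n` as `q` blocks of length `k` plus a remainder. The strong law controls the blocks, each
junction costs `D`, and the remainder is at most `|B| * k`, negligible against `n`. -/
lemma ae_eventually_lt (hF : IsBlockFunctional F B) (p : unitInterval) {D : ℝ}
    (hD : ∀ i m k, i ≤ m → m ≤ k → ∀ g, F i k g ≤ F i m g + F m k g + D) {k : ℕ} (hk : k ≠ 0)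
    {c : ℝ} (hc : ((∫ g, F 0 k g ∂configMeasure p) + D) / k < c) :
    ∀ᵐ g ∂configMeasure p, ∀ᶠ n : ℕ in atTop, F 0 n g / n < c := by
  have hk' : (0 : ℝ) < k := by exact_mod_cast hk.bot_lt
  obtain ⟨c', h1, h2⟩ := exists_between hc
  filter_upwards [hF.ae_tendsto_blocks p k] with g hg
  have h3 : (∫ g, F 0 k g ∂configMeasure p) < c' * k - D := by
    rw [div_lt_iff₀ hk'] at h1
    linarith
  have h4 := ((tendsto_order.1 hg).2 _ h3).and (eventually_gt_atTop 0)
  have h5 := (Nat.tendsto_div_const_atTop hk).eventually h4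
  have h6 : ∀ᶠ n : ℕ in atTop, (|c' * k| + D + |B| * k) / n < c - c' :=
    (tendsto_order.1 (tendsto_const_div_atTop_nhds_zero_nat _)).2 _ (by linarith)
  filter_upwards [h5, h6, eventually_gt_atTop 0] with n h5 h6 hn
  obtain ⟨h5, hq⟩ := h5
  set q := n / k with hqdef
  have hn' : (0 : ℝ) < n := by exact_mod_cast hn
  have hq' : (0 : ℝ) < q := by exact_mod_cast hq
  rw [div_lt_iff₀ hq'] at h5
  rw [div_lt_iff₀ hn'] at h6 ⊢
  have h7 : q * k ≤ n := Nat.div_mul_le_self n k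
  have h8 : n < (q + 1) * k := by
    rw [mul_comm]
    exact Nat.lt_mul_div_succ n hk.bot_lt
  have h7' : (q * k : ℝ) ≤ n := by exact_mod_cast h7
  have h8' : (n : ℝ) < (q + 1) * k := by exact_mod_cast h8
  have h9 := hF.le_sum_blocks hD k q g
  have h10 := hD 0 (q * k) n (by positivity) (by exact_mod_cast h7) g
  have h11 := le_of_abs_le (hF.abs_le (q * k) n (by exact_mod_cast h7) g)
  push_cast at h11
  have h12 : B * (n - q * k) ≤ |B| * k :=
    mul_le_mul (le_abs_self B) (by linarith) (by linarith) (abs_nonneg B)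
  -- Since `c'` may have either sign, the difference between `k * q` and `n` is absorbed in absolute
  -- value.
  have h13 : c' * (k * q) ≤ c' * n + |c' * k| := by
    have h14 : c' * (k * q - n) ≤ |c'| * k := by
      refine (le_abs_self _).trans ?_
      rw [abs_mul]
      gcongr
      rw [_root_.abs_le]
      constructor <;> linarith
    rw [abs_mul, abs_of_pos hk']
    linarith
  nlinarith

lemma subadditive_integral (hF : IsBlockFunctional F B) (p : unitInterval) {D : ℝ}
    (hD : ∀ i m k, i ≤ m → m ≤ k → ∀ g, F i k g ≤ F i m g + F m k g + D) (m n : ℕ) :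
    ∫ g, F 0 (m + n : ℕ) g ∂configMeasure p ≤
      (∫ g, F 0 m g ∂configMeasure p) + (∫ g, F 0 n g ∂configMeasure p) + D := by
  have h1 := hF.integral_add p 0 n m
  rw [zero_add, add_comm (n : ℤ) m] at h1
  have i1 := hF.integrable p (i := 0) (j := m) (by simp)
  have i2 := hF.integrable p (i := m) (j := m + n) (by simp)
  rw [← h1, ← MeasureTheory.integral_add i1 i2]
  have h2 : (∫ g, F 0 m g + F m (m + n) g ∂configMeasure p) + D =
      ∫ g, F 0 m g + F m (m + n) g + D ∂configMeasure p := by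
    have := MeasureTheory.integral_add (i1.add i2) (integrable_const D)
    simp only [Pi.add_apply, integral_const, probReal_univ, one_smul] at this
    exact this.symm
  rw [h2]
  refine integral_mono (hF.integrable p (by positivity)) ((i1.add i2).add (integrable_const D))
    fun g => ?_
  push_cast
  exact hD 0 m (m + n) (by simp) (by simp) g

lemma abs_integral_le (hF : IsBlockFunctional F B) (p : unitInterval) (n : ℕ) :
    |∫ g, F 0 n g ∂configMeasure p| ≤ B * n := by
  have h : ∀ᵐ g ∂configMeasure p, ‖F 0 n g‖ ≤ B * n :=
    ae_of_all _ fun g => by simpa using hF.abs_le 0 n (by simp) g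
  simpa using norm_integral_le_of_norm_le_const h

lemma bddBelow_integral_div (hF : IsBlockFunctional F B) (p : unitInterval) :
    BddBelow (Set.range fun n : ℕ => (∫ g, F 0 n g ∂configMeasure p) / n) := by
  refine ⟨-|B|, ?_⟩
  rintro _ ⟨n, rfl⟩
  rcases n.eq_zero_or_pos with rfl | hn
  · simp
  · have hn' : (0 : ℝ) < n := by exact_mod_cast hn
    have h1 := neg_le_of_abs_le (hF.abs_integral_le p n)
    have h2 : B * n ≤ |B| * n := by
      gcongr
      exact le_abs_self B
    simp only
    rw [le_div_iff₀ hn']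
    linarith

end IsBlockFunctional

/-- Rational thresholds suffice, so a countable intersection moves the quantifier inside the almost
sure event. -/
lemma ae_forall_gt_of_forall_gt_ae {Ω : Type*} [MeasurableSpace Ω] {P : Measure Ω}
    {X : ℕ → Ω → ℝ} {c : ℝ} (h : ∀ c', c < c' → ∀ᵐ ω ∂P, ∀ᶠ n in atTop, X n ω < c') :
    ∀ᵐ ω ∂P, ∀ c', c < c' → ∀ᶠ n in atTop, X n ω < c' := by
  have h1 : ∀ᵐ ω ∂P, ∀ q : ℚ, c < q → ∀ᶠ n in atTop, X n ω < q :=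
    ae_all_iff.2 fun q => by
      by_cases hq : c < q
      · filter_upwards [h q hq] with ω hω _
        exact hω
      · exact ae_of_all _ fun _ h => absurd h hq
  filter_upwards [h1] with ω hω c' hc'
  obtain ⟨q, hq, hq'⟩ := exists_rat_btwn hc'
  filter_upwards [hω q hq] with n hn
  exact hn.trans hq'

namespace IsBlockFunctional

variable {F : ℤ → ℤ → Config → ℝ} {B : ℝ}

lemma ae_limsup_le (hF : IsBlockFunctional F B) (p : unitInterval) {D c : ℝ}
    (hD : ∀ i m k, i ≤ m → m ≤ k → ∀ g, F i k g ≤ F i m g + F m k g + D)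
    (hc : Tendsto (fun n : ℕ => (∫ g, F 0 n g ∂configMeasure p) / n) atTop (𝓝 c)) :
    ∀ᵐ g ∂configMeasure p, ∀ c', c < c' → ∀ᶠ n : ℕ in atTop, F 0 n g / n < c' := by
  refine ae_forall_gt_of_forall_gt_ae fun c' hc' => ?_
  have h1 : Tendsto (fun n : ℕ => ((∫ g, F 0 n g ∂configMeasure p) + D) / n) atTop (𝓝 c) := by
    have := hc.add (tendsto_const_div_atTop_nhds_zero_nat D)
    simpa only [add_div, add_zero] using this
  -- One large `k` makes the defect `D / k` harmless.
  obtain ⟨k, hk, hk0⟩ := (((tendsto_order.1 h1).2 c' hc').and (eventually_ne_atTop 0)).exists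
  exact hF.ae_eventually_lt p hD hk0 hk

/-- A superadditive block functional that is subadditive up to a constant satisfies a law of large
numbers. -/
lemma exists_ae_tendsto (hF : IsBlockFunctional F B) (p : unitInterval) {D : ℝ}
    (hsup : ∀ i m k, i ≤ m → m ≤ k → ∀ g, F i m g + F m k g ≤ F i k g)
    (hsub : ∀ i m k, i ≤ m → m ≤ k → ∀ g, F i k g ≤ F i m g + F m k g + D) :
    ∃ c : ℝ, TendstoAS (configMeasure p) (fun n g => F 0 n g / n) c := by
  have hneg : ∀ i m k, i ≤ m → m ≤ k → ∀ g, -F i k g ≤ -F i m g + -F m k g + 0 :=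
    fun i m k h1 h2 g => by linarith [hsup i m k h1 h2 g]
  have hu : Subadditive fun n : ℕ => ∫ g, -F 0 n g ∂configMeasure p := fun m n => by
    simpa using hF.neg.subadditive_integral p hneg m n
  obtain ⟨c, h1⟩ : ∃ c, Tendsto (fun n : ℕ => (∫ g, -F 0 n g ∂configMeasure p) / n) atTop (𝓝 c) :=
    ⟨_, hu.tendsto_lim (hF.neg.bddBelow_integral_div p)⟩
  refine ⟨-c, ?_⟩
  have h2 := h1.neg
  simp only [integral_neg, neg_div, neg_neg] at h2
  filter_upwards [hF.neg.ae_limsup_le p hneg h1, hF.ae_limsup_le p hsub h2] with g h3 h4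
  refine tendsto_order.2 ⟨fun c' hc' => ?_, h4⟩
  filter_upwards [h3 (-c') (by linarith)] with n hn
  rw [neg_div] at hn
  linarith

end IsBlockFunctional

/-! ### Maximum weight and longest path as block functionals -/

lemma setOf_mark_eq_one (g : Config) : (fun k l => mark k l g = 1) = rel g := by
  ext k l
  exact mark_eq_one_iff

lemma mark_shift (m : ℤ) (g : Config) (i j : ℤ) :
    mark i j (shift m g) = mark (i + m) (j + m) g := by
  unfold mark
  split_ifs with h1 h2 h2
  · rfl
  · exact absurd ((rel_shift m g i j).1 h1) h2
  · exact absurd ((rel_shift m g i j).2 h2) h1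
  · rfl

lemma mark_congr {a b : ℤ} {g g' : Config} (h : ∀ e ∈ edgesIn a b, g e = g' e) {i j : ℤ}
    (hi : a ≤ i) (hj : j ≤ b) : mark i j g = mark i j g' := by
  unfold mark
  have := rel_congr h hi hj
  split_ifs <;> tauto

lemma isBlockFunctional_maxWeight (x : ℝ) :
    IsBlockFunctional (fun i j g => maxWeight (edgeWeight x fun k l => mark k l g) i j)
      (max 1 |x|) where
  dependsOn i j g g' h := maxWeight_congr fun a b ha _ hb => by
    simp only [edgeWeight, mark_congr h ha hb]
  shift i j m g := maxWeight_map m fun a b _ _ _ => by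
    simp only [edgeWeight, mark_shift]
  abs_le i j h g := abs_maxWeight_le (fun k l _ => abs_edgeWeight_le x (mark_zero_or_one k l g)) h

lemma isBlockFunctional_longest :
    IsBlockFunctional (fun i j g => (longest (rel g) i j : ℝ)) 1 where
  dependsOn i j g g' h := by
    simp only [Nat.cast_inj]
    exact longest_congr fun a b ha _ hb => rel_congr h ha hb.le
  shift i j m g := by
    rw [Nat.cast_inj]
    exact longest_map m fun a b _ _ _ => (rel_shift m g a b).symm
  abs_le i j h g := by
    rw [Nat.abs_cast, one_mul, ← Int.cast_sub, ← Int.cast_natCast, Int.cast_le]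
    have := longest_le (R := rel g) i j
    lia

lemma exists_ae_tendsto_maxWeight (p : unitInterval) (x : ℝ) :
    ∃ c : ℝ, TendstoAS (configMeasure p)
      (fun n g => maxWeight (edgeWeight x fun k l => mark k l g) 0 n / n) c := by
  have hB : 0 ≤ max 1 |x| := le_max_of_le_left zero_le_one
  -- Rerouting an edge involves three edge weights, each at most `max 1 |x|` in absolute value.
  refine (isBlockFunctional_maxWeight x).exists_ae_tendsto p (D := 3 * max 1 |x|)
    (fun i m k h1 h2 g => maxWeight_add_le h1 h2)
    (fun i m k h1 h2 g => maxWeight_le_add (by positivity) (fun i m j _ _ => ?_) h1 h2)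
  have h := fun k l => abs_le.1 (abs_edgeWeight_le x (a := fun k l => mark k l g)
    (mark_zero_or_one k l g))
  linarith [h i j, h i m, h m j]

/-! ### Joining distant vertices by two marked edges -/

/-- Different intermediate vertices `x` use disjoint pairs of edges, so the factors are independent,
each with mean `1 - p ^ 2`. -/
lemma integral_prod_one_sub (p : unitInterval) {a b : ℤ} {s : Finset ℤ}
    (hs : s ⊆ Finset.Ioo a b) :
    ∫ g, ∏ x ∈ s, (1 - mark a x g * mark x b g) ∂configMeasure p = (1 - (p : ℝ) ^ 2) ^ s.card := by
  induction s using Finset.induction_on with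
  | empty => simp
  | insert x s hx ih =>
    rw [Finset.insert_subset_iff, Finset.mem_Ioo] at hs
    obtain ⟨⟨hax, hxb⟩, hs⟩ := hs
    simp_rw [Finset.prod_insert hx]
    have d1 : DependsOn (fun g => 1 - mark a x g * mark x b g)
        ({⟨(a, x), hax⟩, ⟨(x, b), hxb⟩} : Set Edge) := fun g g' h => by
      have h1 := dependsOn_mark hax fun e he => h e (Or.inl he)
      have h2 := dependsOn_mark hxb fun e he => h e (Or.inr he)
      simp only [h1, h2]
    have d2 : DependsOn (fun g => ∏ x ∈ s, (1 - mark a x g * mark x b g))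
        {e : Edge | e ∈ edgesIn a b ∧ (e.1.1 ∈ s ∨ e.1.2 ∈ s)} := fun g g' h => by
      refine Finset.prod_congr rfl fun y hy => ?_
      have hy' := Finset.mem_Ioo.1 (hs hy)
      have h1 := dependsOn_mark hy'.1 (x := g) (y := g') fun e he => h e (by
        obtain rfl := he
        exact ⟨⟨le_rfl, hy'.2.le⟩, Or.inr hy⟩)
      have h2 := dependsOn_mark hy'.2 (x := g) (y := g') fun e he => h e (by
        obtain rfl := he
        exact ⟨⟨hy'.1.le, le_rfl⟩, Or.inl hy⟩)
      rw [h1, h2]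
    have f1 : ({⟨(a, x), hax⟩, ⟨(x, b), hxb⟩} : Set Edge).Finite := Set.toFinite _
    have f2 : {e : Edge | e ∈ edgesIn a b ∧ (e.1.1 ∈ s ∨ e.1.2 ∈ s)}.Finite :=
      (finite_edgesIn a b).subset fun e he => he.1
    have hdisj : Disjoint ({⟨(a, x), hax⟩, ⟨(x, b), hxb⟩} : Set Edge)
        {e : Edge | e ∈ edgesIn a b ∧ (e.1.1 ∈ s ∨ e.1.2 ∈ s)} := by
      have ha : a ∉ s := fun h => by simpa using hs h
      have hb : b ∉ s := fun h => by simpa using hs h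
      rw [Set.disjoint_left]
      rintro e (rfl | rfl) ⟨_, h⟩ <;> simp [hx, ha, hb] at h
    rw [(indepFun_of_dependsOn p d1 d2 f1 f2 hdisj).integral_fun_mul_eq_mul_integral
      (measurable_of_dependsOn d1 f1).aestronglyMeasurable
      (measurable_of_dependsOn d2 f2).aestronglyMeasurable, ih hs, Finset.card_insert_of_notMem hx,
      pow_succ' (1 - (p : ℝ) ^ 2)]
    congr 1
    have m1 := measurable_of_dependsOn (dependsOn_mark hax) (Set.finite_singleton _)
    have m2 := measurable_of_dependsOn (dependsOn_mark hxb) (Set.finite_singleton _)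
    have hi : IndepFun (mark a x) (mark x b) (configMeasure p) :=
      indepFun_of_dependsOn p (dependsOn_mark hax) (dependsOn_mark hxb) (Set.finite_singleton _)
        (Set.finite_singleton _) (by
          rw [Set.disjoint_singleton]
          intro h
          simp only [Subtype.mk.injEq, Prod.mk.injEq] at h
          lia)
    have hint : Integrable (fun g => mark a x g * mark x b g) (configMeasure p) := by
      refine Integrable.of_bound (m1.mul m2).aestronglyMeasurable 1 (ae_of_all _ fun g => ?_)
      rcases mark_zero_or_one a x g with h | h <;> rcases mark_zero_or_one x b g with h' | h' <;>
        simp [h, h']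
    rw [integral_sub (integrable_const 1) hint, hi.integral_fun_mul_eq_mul_integral
      m1.aestronglyMeasurable m2.aestronglyMeasurable, integral_mark p hax, integral_mark p hxb]
    simp [sq]

/-- The product over intermediate vertices equals `1` on this event, so Markov's inequality at level
`1` applies; there are at least `k` such vertices. -/
lemma measure_not_twoStep_le (p : unitInterval) {a b : ℤ} {k : ℕ} (h : a + k + 1 ≤ b) :
    configMeasure p {g | ¬TwoStep (rel g) a b} ≤ ENNReal.ofReal ((1 - (p : ℝ) ^ 2) ^ k) := by
  have hp0 : (0 : ℝ) ≤ p := p.2.1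
  have hp1 : (p : ℝ) ≤ 1 := p.2.2
  have hint : Integrable (fun g => ∏ x ∈ Finset.Ioo a b, (1 - mark a x g * mark x b g))
      (configMeasure p) := by
    refine Integrable.of_bound (Measurable.aestronglyMeasurable ?_) 1 (ae_of_all _ fun g => ?_)
    · refine Finset.measurable_fun_prod _ fun x hx => ?_
      rw [Finset.mem_Ioo] at hx
      exact measurable_const.sub
        ((measurable_of_dependsOn (dependsOn_mark hx.1) (Set.finite_singleton _)).mul
        (measurable_of_dependsOn (dependsOn_mark hx.2) (Set.finite_singleton _)))
    · rw [norm_prod]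
      refine Finset.prod_le_one (fun _ _ => norm_nonneg _) fun x _ => ?_
      rcases mark_zero_or_one a x g with h | h <;> rcases mark_zero_or_one x b g with h' | h' <;>
        simp [h, h']
  have h1 := mul_meas_ge_le_integral_of_nonneg (μ := configMeasure p) (ae_of_all _ fun g => ?_)
    hint 1
  · rw [integral_prod_one_sub p (Finset.Subset.refl _), one_mul] at h1
    rw [← ENNReal.ofReal_toReal (measure_ne_top (configMeasure p) {g | ¬TwoStep (rel g) a b})]
    refine ENNReal.ofReal_le_ofReal (le_trans (le_trans ?_ h1) ?_)
    · refine measureReal_mono fun g hg => ?_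
      refine (Finset.prod_eq_one (f := fun x => 1 - mark a x g * mark x b g) fun x hx => ?_).ge
      rw [Finset.mem_Ioo] at hx
      have h2 : ¬(rel g a x ∧ rel g x b) := fun h => hg ⟨x, hx.1, hx.2, h.1, h.2⟩
      rw [sub_eq_self, mul_eq_zero]
      rcases mark_zero_or_one a x g with h | h
      · exact Or.inl h
      rcases mark_zero_or_one x b g with h' | h'
      · exact Or.inr h'
      · exact absurd ⟨mark_eq_one_iff.1 h, mark_eq_one_iff.1 h'⟩ h2
    · refine pow_le_pow_of_le_one (by nlinarith) (by nlinarith) ?_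
      rw [Int.card_Ioo]
      lia
  · refine Finset.prod_nonneg fun x _ => ?_
    rcases mark_zero_or_one a x g with h | h <;> rcases mark_zero_or_one x b g with h' | h' <;>
      simp [h, h']

lemma summable_add_two_pow_mul_geometric (d : ℕ) {r : ℝ} (hr0 : 0 ≤ r) (hr1 : r < 1) :
    Summable fun k : ℕ => ((k : ℝ) + 2) ^ d * r ^ k := by
  have h0 : Summable fun k : ℕ => (k : ℝ) ^ d * r ^ k :=
    summable_pow_mul_geometric_of_norm_lt_one d (by rwa [Real.norm_of_nonneg hr0])
  have h1 := h0.mul_left ((3 : ℝ) ^ d)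
  refine Summable.of_norm_bounded_eventually_nat h1 ?_
  filter_upwards [eventually_ge_atTop 1] with k hk
  have hk' : (1 : ℝ) ≤ k := by exact_mod_cast hk
  rw [Real.norm_of_nonneg (by positivity), ← mul_assoc, ← mul_pow]
  gcongr
  linarith

/-- Almost surely, for all large `k`, any two vertices of `[0, (k + 1) ^ 4]` at distance more than
`k` are joined by two edges. -/
lemma ae_eventually_twoStep (p : unitInterval) (hp : 0 < (p : ℝ)) :
    ∀ᵐ g ∂configMeasure p, ∀ᶠ k : ℕ in atTop, ∀ a b : ℤ, 0 ≤ a → a + (k + 1 : ℕ) ≤ b →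
      b ≤ ((k + 1) ^ 4 : ℕ) → TwoStep (rel g) a b := by
  have hp1 : (p : ℝ) ≤ 1 := p.2.2
  set r : ℝ := 1 - (p : ℝ) ^ 2 with hr
  have hr0 : 0 ≤ r := by nlinarith
  have hr1 : r < 1 := by nlinarith
  let A : ℕ → Set Config := fun k => {g | ¬∀ a b : ℤ, 0 ≤ a → a + (k + 1 : ℕ) ≤ b →
      b ≤ ((k + 1) ^ 4 : ℕ) → TwoStep (rel g) a b}
  have hA : ∀ k, configMeasure p (A k) ≤
      ENNReal.ofReal (((k : ℝ) + 2) ^ 8 * r ^ k) := by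
    intro k
    let I : Finset (ℤ × ℤ) := (Finset.Icc 0 (((k + 1) ^ 4 : ℕ) : ℤ) ×ˢ
      Finset.Icc 0 (((k + 1) ^ 4 : ℕ) : ℤ)).filter fun e => e.1 + k + 1 ≤ e.2
    have h1 : A k ⊆ ⋃ e ∈ I, {g | ¬TwoStep (rel g) e.1 e.2} := by
      intro g hg
      simp only [A, Set.mem_ofPred_eq, not_forall] at hg
      obtain ⟨a, b, ha, hab, hb, h⟩ := hg
      refine Set.mem_biUnion (x := (a, b)) ?_ h
      simp only [I, Finset.coe_filter, Finset.mem_product, Finset.mem_Icc, Set.mem_ofPred_eq]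
      refine ⟨⟨⟨ha, ?_⟩, ?_, hb⟩, ?_⟩ <;> lia
    -- The number of pairs is polynomial in `k`, so the geometric factor `r ^ k` makes the union
    -- bound summable.
    have h2 : (I.card : ℝ) ≤ ((k : ℝ) + 2) ^ 8 := by
      have h3 : I.card ≤ ((k + 1) ^ 4 + 1) * ((k + 1) ^ 4 + 1) :=
        (Finset.card_filter_le _ _).trans (by
          rw [Finset.card_product, Int.card_Icc, sub_zero, Int.toNat_natCast_add_one])
      have h4 : (k + 1) ^ 4 + 1 ≤ (k + 2) ^ 4 := Nat.pow_lt_pow_left (by lia) (by lia)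
      have h5 : I.card ≤ (k + 2) ^ 8 :=
        h3.trans ((Nat.mul_le_mul h4 h4).trans (by rw [← pow_add]))
      exact_mod_cast h5
    calc configMeasure p (A k) ≤ ∑ e ∈ I, configMeasure p {g | ¬TwoStep (rel g) e.1 e.2} :=
          (measure_mono h1).trans (measure_biUnion_finset_le _ _)
      _ ≤ ∑ e ∈ I, ENNReal.ofReal (r ^ k) :=
          Finset.sum_le_sum fun e he => measure_not_twoStep_le p (Finset.mem_filter.1 he).2
      _ = ENNReal.ofReal (I.card * r ^ k) := by
          rw [Finset.sum_const, nsmul_eq_mul, ENNReal.ofReal_mul (by positivity),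
            ENNReal.ofReal_natCast]
      _ ≤ _ := ENNReal.ofReal_le_ofReal (by gcongr)
  have hsum := summable_add_two_pow_mul_geometric 8 hr0 hr1
  have h3 : ∑' k, configMeasure p (A k) ≠ ⊤ :=
    ne_top_of_le_ne_top hsum.tsum_ofReal_ne_top (ENNReal.tsum_le_tsum hA)
  filter_upwards [ae_eventually_notMem h3] with g hg
  filter_upwards [hg] with k hk
  simpa only [A, Set.mem_ofPred_eq, not_not] using hk

/-! ### Linear growth of the mean longest path -/

/-- `i` is the last vertex of a longest path in `[0, n)`. -/
def IsLastVertex (n : ℕ) (g : Config) (i : ℕ) : Prop :=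
  i < n ∧ ∃ (a : ℤ) (m : ℕ), 0 ≤ a ∧ OnePath (rel g) a i m ∧ longest (rel g) 0 n = m + 1

/-- The smallest last vertex of a longest path in `[0, n)`. -/
noncomputable def lastVertex (n : ℕ) (g : Config) : ℕ := sInf {i | IsLastVertex n g i}

lemma isLastVertex_lastVertex {n : ℕ} (hn : 0 < n) (g : Config) :
    IsLastVertex n g (lastVertex n g) := by
  obtain ⟨a, j, m, h1, h2, h3, h4⟩ := exists_longest (R := rel g) (a := 0) (b := n) (by lia)
  have h5 := h3.le
  lift j to ℕ using h1.trans h5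
  exact Nat.sInf_mem (s := {i | IsLastVertex n g i}) ⟨j, by lia, a, m, h1, h3, h4⟩

lemma IsLastVertex.congr {n i : ℕ} {g g' : Config} (h : ∀ e ∈ edgesIn 0 (n - 1), g e = g' e)
    (hi : IsLastVertex n g i) : IsLastVertex n g' i := by
  obtain ⟨h1, a, m, h2, h3, h4⟩ := hi
  refine ⟨h1, a, m, h2, ?_, ?_⟩
  · have h5 : OnePath (rel g') (a + 0) (i + 0) m := h3.map fun c d hc _ hd hcd => by
      rw [add_zero, add_zero]
      exact (rel_congr h (h2.trans hc) (by lia)).1 hcd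
    simpa using h5
  · rw [← h4]
    exact longest_congr fun c d hc _ hd => (rel_congr h hc (by lia)).symm

/-- Hence the selected vertex is independent of every edge ending at `n`. -/
lemma dependsOn_lastVertex (n : ℕ) : DependsOn (lastVertex n) (edgesIn 0 (n - 1)) := by
  intro g g' h
  unfold lastVertex
  congr 1
  ext i
  exact ⟨fun hi => hi.congr h, fun hi => hi.congr fun e he => (h e he).symm⟩

lemma longest_add_mark_le {n : ℕ} (hn : 0 < n) (g : Config) :
    longest (rel g) 0 n + mark (lastVertex n g) n g ≤ longest (rel g) 0 (n + 1 : ℕ) := by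
  obtain ⟨h1, a, m, h2, h3, h4⟩ := isLastVertex_lastVertex hn g
  rcases mark_zero_or_one (lastVertex n g) n g with h | h
  · rw [h, add_zero, h4]
    exact_mod_cast h3.succ_le_longest h2 (by lia)
  · have h5 := h3.trans (OnePath.cons (by lia) (mark_eq_one_iff.1 h) (OnePath.nil _))
    rw [h, h4]
    exact_mod_cast h5.succ_le_longest h2 (by lia)

lemma integral_mark_lastVertex (p : unitInterval) {n : ℕ} (hn : 0 < n) :
    Integrable (fun g => mark (lastVertex n g) n g) (configMeasure p) ∧
      ∫ g, mark (lastVertex n g) n g ∂configMeasure p = p := by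
  let X : ℕ → Config → ℝ := fun i g => if lastVertex n g = i then 1 else 0
  have hX : ∀ i, DependsOn (X i) (edgesIn 0 (n - 1)) := fun i g g' h => by
    simp only [X, dependsOn_lastVertex n h]
  have hXm : ∀ i, Measurable (X i) := fun i =>
    measurable_of_dependsOn (hX i) (finite_edgesIn _ _)
  have hY : ∀ i ∈ Finset.range n, Measurable (mark i n) := fun i hi =>
    measurable_of_dependsOn (dependsOn_mark (by simpa using hi)) (Set.finite_singleton _)
  -- Splitting by the value of the random vertex leaves marks of fixed edges into `n`, independent
  -- of the indicators.
  have hsum : (fun g => mark (lastVertex n g) n g) =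
      fun g => ∑ i ∈ Finset.range n, X i g * mark i n g := by
    ext g
    simp [X, (isLastVertex_lastVertex hn g).1]
  have hint : ∀ i ∈ Finset.range n,
      Integrable (fun g => X i g * mark i n g) (configMeasure p) := fun i hi => by
    refine Integrable.of_bound ((hXm i).mul (hY i hi)).aestronglyMeasurable 1
      (ae_of_all _ fun g => ?_)
    simp only [X]
    rcases mark_zero_or_one i n g with h | h <;> split_ifs <;> simp [h]
  have hXint : ∀ i ∈ Finset.range n, Integrable (X i) (configMeasure p) := fun i _ => by
    refine Integrable.of_bound (hXm i).aestronglyMeasurable 1 (ae_of_all _ fun g => ?_)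
    simp only [X]
    split_ifs <;> simp
  rw [hsum]
  refine ⟨integrable_finsetSum _ hint, ?_⟩
  rw [integral_finsetSum _ hint]
  have h1 : ∀ i ∈ Finset.range n, ∫ g, X i g * mark i n g ∂configMeasure p =
      (∫ g, X i g ∂configMeasure p) * p := fun i hi => by
    have hi' : (i : ℤ) < n := by simpa using hi
    rw [(indepFun_of_dependsOn p (hX i) (dependsOn_mark hi') (finite_edgesIn _ _)
      (Set.finite_singleton _) ?_).integral_fun_mul_eq_mul_integral (hXm i).aestronglyMeasurable
      (hY i hi).aestronglyMeasurable, integral_mark p hi']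
    rw [Set.disjoint_singleton_right]
    rintro ⟨_, h⟩
    simp only at h
    lia
  rw [Finset.sum_congr rfl h1, ← Finset.sum_mul, ← integral_finsetSum _ hXint]
  have h2 : ∀ g, ∑ i ∈ Finset.range n, X i g = 1 := fun g => by
    simp [X, (isLastVertex_lastVertex hn g).1]
  simp [h2]

lemma mul_le_integral_longest (p : unitInterval) (n : ℕ) :
    (p : ℝ) * n ≤ ∫ g, (longest (rel g) 0 n : ℝ) ∂configMeasure p := by
  have hint : ∀ m : ℕ, Integrable (fun g => (longest (rel g) 0 m : ℝ)) (configMeasure p) :=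
    fun m => isBlockFunctional_longest.integrable p (i := 0) (j := m) (by simp)
  induction n with
  | zero => simp [longest_self]
  | succ n ih =>
    rcases n.eq_zero_or_pos with rfl | hn
    -- The interval `[0, 1)` has no edge to extend along, but its single vertex already counts `1 ≥
    -- p`.
    · have h1 : ∀ g : Config, (1 : ℝ) ≤ longest (rel g) 0 (0 + 1 : ℕ) := fun g => by
        exact_mod_cast (OnePath.nil (R := rel g) 0).succ_le_longest le_rfl (by simp)
      have h2 := integral_mono (μ := configMeasure p) (integrable_const (1 : ℝ)) (hint _) h1
      simp only [integral_const, probReal_univ, smul_eq_mul, mul_one] at h2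
      have := p.2.2
      push_cast at h2 ⊢
      linarith
    · obtain ⟨h1, h2⟩ := integral_mark_lastVertex p hn
      have h3 := integral_mono ((hint n).add h1) (hint (n + 1))
        (fun g => longest_add_mark_le hn g)
      simp only [Pi.add_apply] at h3
      rw [integral_add (hint n) h1, h2] at h3
      push_cast at h3 ⊢
      linarith

/-! ### Concentration of sums over separated blocks -/

namespace IsBlockFunctional

variable {F : ℤ → ℤ → Config → ℝ} {B : ℝ}

/-- Chebyshev's inequality: the blocks are pairwise independent, so variances add, and each is at
most `(B * K) ^ 2` by boundedness. -/
lemma measure_sum_blocks_le (hF : IsBlockFunctional F B) (p : unitInterval) (m : ℕ) {K s : ℕ}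
    (hs : s ≤ K) {t : ℝ} (ht : 0 < t) :
    configMeasure p {g | ∑ j ∈ Finset.range m, F (j * K + s) ((j + 1) * K) g ≤
      m * (∫ g, F 0 (K - s : ℕ) g ∂configMeasure p) - t} ≤
      ENNReal.ofReal (m * (B * K) ^ 2 / t ^ 2) := by
  have hle : ∀ j : ℕ, (j * K + s : ℤ) ≤ (j + 1) * K := fun j => by
    have : (s : ℤ) ≤ K := by exact_mod_cast hs
    linarith
  have hident : ∀ j : ℕ, IdentDistrib (F (j * K + s) ((j + 1) * K)) (F 0 (K - s : ℕ))
      (configMeasure p) (configMeasure p) := fun j => by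
    have h := hF.identDistrib p 0 (K - s : ℕ) (j * K + s)
    rw [zero_add] at h
    convert h using 2
    push_cast [hs]
    ring
  have hmem : ∀ j ∈ Finset.range m, MemLp (F (j * K + s) ((j + 1) * K)) 2 (configMeasure p) :=
    fun j _ => hF.memLp p (hle j) 2
  set S : Config → ℝ := ∑ j ∈ Finset.range m, F (j * K + s) ((j + 1) * K) with hS
  have hmean : ∫ g, S g ∂configMeasure p =
      m * ∫ g, F 0 (K - s : ℕ) g ∂configMeasure p := by
    simp only [hS, Finset.sum_apply]
    rw [integral_finsetSum _ fun j _ => hF.integrable p (hle j),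
      Finset.sum_congr rfl fun j _ => (hident j).integral_eq]
    simp
  have hvar : variance S (configMeasure p) ≤ m * (B * K) ^ 2 := by
    rw [hS, IndepFun.variance_sum hmem fun i _ j _ hij => hF.pairwise_indepFun p K s hij]
    have h1 : ∀ j ∈ Finset.range m, variance (F (j * K + s) ((j + 1) * K)) (configMeasure p) ≤
        (B * K) ^ 2 := fun j _ => by
      have h2 : ∀ g, |F (j * K + s) ((j + 1) * K) g| ≤ |B * K| := fun g => by
        refine (hF.abs_le _ _ (hle j) g).trans ?_
        have h3 : (s : ℝ) ≤ K := by exact_mod_cast hs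
        push_cast
        rw [abs_mul, Nat.abs_cast]
        refine mul_le_mul (le_abs_self B) ?_ ?_ (abs_nonneg B) <;> linarith [s.cast_nonneg (α := ℝ)]
      have h4 := variance_le_sq_of_bounded (μ := configMeasure p) (a := -|B * K|) (b := |B * K|)
        (ae_of_all _ fun g => _root_.abs_le.1 (h2 g)) (hF.measurable _ _).aemeasurable
      have h5 : ((|B * K| - -|B * K|) / 2) ^ 2 = (B * K) ^ 2 := by
        rw [← sq_abs (B * K)]
        ring
      rwa [h5] at h4
    simpa using Finset.sum_le_sum h1
  refine (measure_mono fun g hg => ?_).trans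
    ((meas_ge_le_variance_div_sq (memLp_finsetSum' _ hmem) ht).trans
      (ENNReal.ofReal_le_ofReal (div_le_div_of_nonneg_right hvar (sq_nonneg t))))
  rw [Set.mem_ofPred_eq] at hg ⊢
  rw [← hS, hmean]
  have h1 : S g = ∑ j ∈ Finset.range m, F (j * K + s) ((j + 1) * K) g := by
    simp [hS]
  rw [← h1] at hg
  refine le_trans ?_ (neg_le_abs _)
  linarith

end IsBlockFunctional

/-- Almost surely, for all large `k`, the sum of the longest paths in separated blocks is not much
smaller than its mean. -/
lemma ae_eventually_sum_longest (p : unitInterval) {ε : ℝ} (hε : 0 < ε) :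
    ∀ᵐ g ∂configMeasure p, ∀ᶠ k : ℕ in atTop,
      ((k ^ 2 - 1 : ℕ) : ℝ) * (∫ g, (longest (rel g) 0 (k ^ 2 - (k + 1) : ℕ) : ℝ) ∂configMeasure p) -
        ε * k ^ 4 <
      ∑ j ∈ Finset.range (k ^ 2 - 1),
        (longest (rel g) (j * (k ^ 2 : ℕ) + (k + 1 : ℕ)) ((j + 1) * (k ^ 2 : ℕ)) : ℝ) := by
  have hsum : Summable fun k : ℕ => 1 / ε ^ 2 * (1 / (k : ℝ) ^ 2) :=
    (Real.summable_one_div_nat_pow.2 one_lt_two).mul_left _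
  -- The condition `2 ≤ k` gives `k + 1 ≤ k ^ 2`, so the gap fits in the block and the subtraction
  -- is not truncated.
  let A : ℕ → Set Config := fun k => {g | 2 ≤ k ∧ ∑ j ∈ Finset.range (k ^ 2 - 1),
      (longest (rel g) (j * (k ^ 2 : ℕ) + (k + 1 : ℕ)) ((j + 1) * (k ^ 2 : ℕ)) : ℝ) ≤
      ((k ^ 2 - 1 : ℕ) : ℝ) *
        (∫ g, (longest (rel g) 0 (k ^ 2 - (k + 1) : ℕ) : ℝ) ∂configMeasure p) - ε * k ^ 4}
  have hA : ∀ k, configMeasure p (A k) ≤ ENNReal.ofReal (1 / ε ^ 2 * (1 / (k : ℝ) ^ 2)) := by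
    intro k
    by_cases hk : 2 ≤ k
    · have hk' : (0 : ℝ) < k := by
        have : 0 < k := by lia
        exact_mod_cast this
      have h1 := isBlockFunctional_longest.measure_sum_blocks_le p (k ^ 2 - 1) (K := k ^ 2)
        (s := k + 1) (by nlinarith) (t := ε * k ^ 4) (by positivity)
      refine (measure_mono fun g hg => hg.2).trans (h1.trans (ENNReal.ofReal_le_ofReal ?_))
      have h2 : ((k ^ 2 - 1 : ℕ) : ℝ) ≤ k ^ 2 := by exact_mod_cast Nat.sub_le _ _
      rw [div_le_iff₀ (by positivity)]
      -- The variance bound is `k ^ 6` and the squared deviation `ε ^ 2 * k ^ 8`, which leaves a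
      -- summable `k⁻²`.
      have h3 : 1 / ε ^ 2 * (1 / (k : ℝ) ^ 2) * (ε * k ^ 4) ^ 2 = k ^ 2 * (1 * k ^ 2) ^ 2 := by
        field_simp
      rw [h3]
      push_cast
      gcongr
    · have : A k = ∅ := by
        ext g
        simp [A, hk]
      simp [this]
  have h3 : ∑' k, configMeasure p (A k) ≠ ⊤ :=
    ne_top_of_le_ne_top hsum.tsum_ofReal_ne_top (ENNReal.tsum_le_tsum hA)
  filter_upwards [ae_eventually_notMem h3] with g hg
  filter_upwards [hg, eventually_ge_atTop 2] with k hk hk2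
  simpa only [A, Set.mem_ofPred_eq, not_and, not_le, hk2, true_implies] using hk

/-! ### The limit for `x = -∞` -/

lemma tendsto_sqrt_sqrt : Tendsto (fun n : ℕ => n.sqrt.sqrt) atTop atTop := by
  have h : Tendsto Nat.sqrt atTop atTop :=
    tendsto_atTop.2 fun b => (eventually_ge_atTop (b * b)).mono fun n hn => Nat.le_sqrt.2 hn
  exact h.comp h

lemma sqrt_sqrt_pow_le (n : ℕ) : n.sqrt.sqrt ^ 4 ≤ n := by
  have h1 := Nat.sqrt_le' n
  have h2 := Nat.sqrt_le' n.sqrt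
  calc n.sqrt.sqrt ^ 4 = (n.sqrt.sqrt ^ 2) ^ 2 := by ring
    _ ≤ n.sqrt ^ 2 := by gcongr
    _ ≤ n := h1

lemma lt_sqrt_sqrt_add_one_pow (n : ℕ) : n < (n.sqrt.sqrt + 1) ^ 4 := by
  have h1 := Nat.lt_succ_sqrt' n
  have h2 := Nat.lt_succ_sqrt' n.sqrt
  calc n < (n.sqrt + 1) ^ 2 := h1
    _ ≤ ((n.sqrt.sqrt + 1) ^ 2) ^ 2 := by gcongr; exact h2
    _ = _ := by ring

/-- Both sides have order `k ^ 4`, and half of the gap `c - c'` remains after the fluctuation term.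
The lower-order losses are at most `(3 * c + 15 * c') * k ^ 3`, where `15 = 4 + 6 + 4 + 1` comes
from expanding `(k + 1) ^ 4`. -/
lemma eventually_mul_pow_le {c c' : ℝ} (hc' : 0 ≤ c') (h : c' < c) :
    ∀ᶠ k : ℕ in atTop, c' * ((k : ℝ) + 1) ^ 4 ≤
      ((k : ℝ) ^ 2 - 1) * (c * ((k : ℝ) ^ 2 - (k + 1))) - (c - c') / 2 * k ^ 4 := by
  have h1 : ∀ᶠ k : ℕ in atTop, (3 * c + 15 * c') / ((c - c') / 2) ≤ k :=
    tendsto_natCast_atTop_atTop.eventually_ge_atTop _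
  filter_upwards [h1, eventually_ge_atTop 1] with k h1 hk
  rw [div_le_iff₀ (by linarith)] at h1
  have hk' : (1 : ℝ) ≤ k := by exact_mod_cast hk
  generalize (k : ℝ) = x at h1 hk'
  have hx2 : x ≤ x ^ 2 := by nlinarith
  have hx3 : x ^ 2 ≤ x ^ 3 := by nlinarith [sq_nonneg x]
  have h2 : (x + 1) ^ 4 ≤ x ^ 4 + 15 * x ^ 3 := by nlinarith
  have h3 : x ^ 4 - 3 * x ^ 3 ≤ (x ^ 2 - 1) * (x ^ 2 - (x + 1)) := by nlinarith
  have h4 : c' * (x + 1) ^ 4 ≤ c' * (x ^ 4 + 15 * x ^ 3) := by gcongr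
  have h5 : c * (x ^ 4 - 3 * x ^ 3) ≤ c * ((x ^ 2 - 1) * (x ^ 2 - (x + 1))) :=
    mul_le_mul_of_nonneg_left h3 (by linarith)
  have h6 : (3 * c + 15 * c') * x ^ 3 ≤ x * ((c - c') / 2) * x ^ 3 := by gcongr
  linarith

lemma exists_ae_tendsto_posMaxBot (p : unitInterval) (hp : 0 < (p : ℝ)) :
    ∃ c : ℝ, 0 < c ∧ TendstoAS (configMeasure p)
      (fun n g => posMaxBot (fun k l => mark k l g) 0 n / n) c := by
  have hV := isBlockFunctional_longest
  have hsub : ∀ i m k : ℤ, i ≤ m → m ≤ k → ∀ g : Config,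
      (longest (rel g) i k : ℝ) ≤ longest (rel g) i m + longest (rel g) m k + 0 :=
    fun i m k _ _ g => by
      rw [add_zero]
      exact_mod_cast longest_le_add i m k
  have hu : Subadditive fun n : ℕ => ∫ g, (longest (rel g) 0 n : ℝ) ∂configMeasure p :=
    fun m n => by simpa using hV.subadditive_integral p hsub m n
  have hbdd := hV.bddBelow_integral_div p
  have hlim := hu.tendsto_lim hbdd
  -- Fekete's limit is an infimum, so it bounds the mean of every block, with no error term.
  have hle : ∀ n : ℕ, hu.lim * n ≤ ∫ g, (longest (rel g) 0 n : ℝ) ∂configMeasure p := fun n => by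
    rcases n.eq_zero_or_pos with rfl | hn
    · simp [longest_self]
    · have := hu.lim_le_div hbdd hn.ne'
      rwa [le_div_iff₀ (by exact_mod_cast hn)] at this
  generalize hu.lim = c at hlim hle
  have hpc : p ≤ c := by
    refine ge_of_tendsto hlim ?_
    filter_upwards [eventually_gt_atTop 0] with n hn
    rw [le_div_iff₀ (by exact_mod_cast hn)]
    exact mul_le_integral_longest p n
  refine ⟨c, hp.trans_le hpc, ?_⟩
  have hlow : ∀ᵐ g ∂configMeasure p, ∀ c', -c < c' →
      ∀ᶠ n : ℕ in atTop, -(posMaxBot (fun k l => mark k l g) 0 n / n) < c' := by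
    refine ae_forall_gt_of_forall_gt_ae fun c₁ hc₁ => ?_
    -- Nonnegativity of `c'` allows `n` to be replaced by the larger `(k + 1) ^ 4` below.
    obtain ⟨c', hc'0, hc'c, hc'1⟩ : ∃ c', 0 ≤ c' ∧ c' < c ∧ -c₁ ≤ c' :=
      ⟨max (-c₁) 0, le_max_right _ _, max_lt (by linarith) (hp.trans_le hpc), le_max_left _ _⟩
    filter_upwards [ae_eventually_twoStep p hp,
      ae_eventually_sum_longest p (ε := (c - c') / 2) (by linarith)] with g h1 h2
    filter_upwards [tendsto_sqrt_sqrt.eventually (h1.and (h2.and ((eventually_mul_pow_le hc'0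
      hc'c).and (eventually_ge_atTop 2)))), eventually_gt_atTop 0] with n hn hn0
    have hkn := sqrt_sqrt_pow_le n
    have hnk := lt_sqrt_sqrt_add_one_pow n
    generalize n.sqrt.sqrt = k at hn hkn hnk
    obtain ⟨h3, h4, h5, hk⟩ := hn
    have hk2 : 1 ≤ k ^ 2 := Nat.one_le_pow _ _ (by lia)
    have hk3 : k + 1 < k ^ 2 := by nlinarith
    -- Using one block fewer than `k ^ 2` leaves room for the final two-edge link to `n`.
    have hkk : (k ^ 2 - 1) * k ^ 2 + (k + 1) ≤ n := by
      obtain ⟨d, hd⟩ := Nat.exists_eq_add_of_le' hk2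
      have : k ^ 4 = (d + 1) * k ^ 2 := by rw [← hd]; ring
      rw [hd] at hk3 ⊢
      rw [Nat.add_sub_cancel, ← hd]
      lia
    obtain ⟨e, he, hs⟩ := exists_onePath_of_twoStep (R := rel g) hk3 h3 hkk hnk.le
    rw [← setOf_mark_eq_one] at he
    have h6 := he.le_posMaxBot
    have h7 : ∑ j ∈ Finset.range (k ^ 2 - 1), (longest (rel g) (j * (k ^ 2 : ℕ) + (k + 1 : ℕ))
        ((j + 1) * (k ^ 2 : ℕ)) : ℝ) ≤ e := by exact_mod_cast hs
    have h8 := hle (k ^ 2 - (k + 1))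
    rw [Nat.cast_sub hk3.le] at h8
    push_cast at h8
    have h9 : ((k ^ 2 - 1 : ℕ) : ℝ) = (k : ℝ) ^ 2 - 1 := by push_cast [hk2]; ring
    have h10 : 0 ≤ (k : ℝ) ^ 2 - 1 := by
      rw [← h9]
      positivity
    have h11 := mul_le_mul_of_nonneg_left h8 h10
    rw [h9] at h4
    have h12 : c' * n ≤ c' * ((k : ℝ) + 1) ^ 4 := by
      gcongr
      exact_mod_cast hnk.le
    have hn' : (0 : ℝ) < n := by exact_mod_cast hn0
    have h13 : c' < posMaxBot (fun k l => mark k l g) 0 n / n := by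
      rw [lt_div_iff₀ hn']
      linarith
    linarith
  filter_upwards [hlow, hV.ae_limsup_le p hsub hlim] with g h1 h2
  refine tendsto_order.2 ⟨fun c' hc' => ?_, fun c' hc' => ?_⟩
  · filter_upwards [h1 (-c') (by linarith)] with n hn
    linarith
  · obtain ⟨c₁, hc₁, hc₁'⟩ := exists_between hc'
    have h3 : ∀ᶠ n : ℕ in atTop, (1 : ℝ) / n < c' - c₁ :=
      (tendsto_order.1 (tendsto_const_div_atTop_nhds_zero_nat 1)).2 _ (by linarith)
    filter_upwards [h2 c₁ hc₁, h3] with n hn hn'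
    have h4 : posMaxBot (fun k l => mark k l g) 0 n ≤ longest (rel g) 0 n + 1 := by
      refine (posMaxBot_le_longest (by simp)).trans ?_
      rw [setOf_mark_eq_one]
      have h5 := longest_le_add (R := rel g) 0 n (n + 1)
      have h6 := longest_le (R := rel g) n (n + 1)
      have h7 : longest (rel g) 0 (n + 1) ≤ longest (rel g) 0 n + 1 := by lia
      exact_mod_cast h7
    have h5 : posMaxBot (fun k l => mark k l g) 0 n / n ≤
        (longest (rel g) 0 n : ℝ) / n + 1 / n := by
      rw [← add_div]
      gcongr
    linarith

/-! ### Assembly and transfer to arbitrary Bernoulli families -/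

/-- The limits for the canonical family of marks. -/
lemma exists_ae_tendsto_config (p : unitInterval) (hp : 0 < (p : ℝ)) :
    ∃ (CBot : ℝ) (C : ℝ → ℝ), 0 < CBot ∧ (∀ x : ℝ, CBot ≤ C x) ∧
      TendstoAS (configMeasure p) (fun n g => posMaxBot (fun k l => mark k l g) 0 n / n) CBot ∧
      ∀ x, TendstoAS (configMeasure p)
        (fun n g => maxWeight (edgeWeight x fun k l => mark k l g) 0 n / n) (C x) := by
  obtain ⟨CBot, h0, h1⟩ := exists_ae_tendsto_posMaxBot p hp
  choose C hC using exists_ae_tendsto_maxWeight p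
  refine ⟨CBot, C, h0, fun x => ?_, h1, hC⟩
  -- Both limits are constants, so they can be compared on a single configuration; `0 < CBot` makes
  -- the positive part eventually nonzero there.
  obtain ⟨g, hg1, hg2⟩ := (h1.and (hC x)).exists
  refine le_of_tendsto_of_tendsto hg1 hg2 ?_
  filter_upwards [(tendsto_order.1 hg1).1 0 h0] with n hn
  gcongr
  refine posMaxBot_le_maxWeight (by simp) ?_ x
  intro h
  simp [h] at hn

lemma tendstoL1_of_tendstoAS {Ω : Type*} [MeasurableSpace Ω] {P : Measure Ω}
    [IsProbabilityMeasure P] {X : ℕ → Ω → ℝ} {c B : ℝ} (h : TendstoAS P X c)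
    (hX : ∀ n, AEStronglyMeasurable (X n) P) (hB : ∀ n, ∀ᵐ ω ∂P, |X n ω| ≤ B) :
    TendstoL1 P X c := by
  refine ⟨fun n => Integrable.of_bound (hX n) B (hB n), ?_⟩
  have h1 := tendsto_integral_of_dominated_convergence (μ := P)
    (F := fun n ω => |X n ω - c|) (f := fun _ => 0) (fun _ => B + |c|)
    (fun n => ((hX n).sub aestronglyMeasurable_const).norm) (integrable_const _) (fun n => ?_) ?_
  · simpa using h1
  · filter_upwards [hB n] with ω hω
    rw [Real.norm_eq_abs, abs_abs]
    exact (abs_sub _ _).trans (by gcongr)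
  · filter_upwards [h] with ω hω
    simpa using (hω.sub_const c).abs

namespace IsBernoulliEdgeFamily

variable {Ω : Type*} [MeasurableSpace Ω] {P : Measure Ω} {α : ℤ → ℤ → Ω → ℝ}

lemma map_decide (p : unitInterval) [IsProbabilityMeasure P]
    (h : IsBernoulliEdgeFamily P p α) :
    Measurable (fun ω (e : Edge) => decide (α e.1.1 e.1.2 ω = 1)) ∧
      P.map (fun ω (e : Edge) => decide (α e.1.1 e.1.2 ω = 1)) = configMeasure p := by
  have hφ : Measurable fun r : ℝ => decide (r = 1) := by
    refine measurable_to_bool ?_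
    have : (fun r : ℝ => decide (r = 1)) ⁻¹' {true} = {1} := by
      ext r
      simp
    rw [this]
    exact measurableSet_singleton 1
  have hX : ∀ e : Edge, Measurable fun ω => decide (α e.1.1 e.1.2 ω = 1) :=
    fun e => hφ.comp (h.measurable _ _ e.2)
  refine ⟨measurable_pi_lambda _ hX, map_eq_configMeasure p hX
    (h.indep.comp (fun _ r => decide (r = 1)) fun _ => hφ) fun e => ?_⟩
  refine Measure.ext_of_singleton fun b => ?_
  rw [Measure.map_apply (hX e) (measurableSet_singleton b)]
  have h1 := h.prob_one _ _ e.2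
  have h2 : MeasurableSet {ω | α e.1.1 e.1.2 ω = 1} :=
    h.measurable _ _ e.2 (measurableSet_singleton 1)
  cases b
  · have h3 : (fun ω => decide (α e.1.1 e.1.2 ω = 1)) ⁻¹' {false} =
        {ω | α e.1.1 e.1.2 ω = 1}ᶜ := by
      ext ω
      simp
    rw [h3, prob_compl_eq_one_sub h2, h1]
    simp [bern, ENNReal.ofReal_sub, p.2.1]
  · have h3 : (fun ω => decide (α e.1.1 e.1.2 ω = 1)) ⁻¹' {true} =
        {ω | α e.1.1 e.1.2 ω = 1} := by
      ext ω
      simp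
    rw [h3, h1]
    simp [bern]

/-- The two prescribed probabilities add up to `1`, so other values have probability zero; there are
only countably many edges. -/
lemma ae_eq_mark {p : ℝ} (hp0 : 0 ≤ p) (hp1 : p ≤ 1) [IsProbabilityMeasure P]
    (h : IsBernoulliEdgeFamily P p α) :
    ∀ᵐ ω ∂P, ∀ i j, i < j → α i j ω = mark i j fun e => decide (α e.1.1 e.1.2 ω = 1) := by
  refine ae_all_iff.2 fun i => ae_all_iff.2 fun j => ?_
  by_cases hij : i < j
  swap
  · exact ae_of_all _ fun _ h => absurd h hij
  have m0 : MeasurableSet {ω | α i j ω = 0} := h.measurable i j hij (measurableSet_singleton 0)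
  have m1 : MeasurableSet {ω | α i j ω = 1} := h.measurable i j hij (measurableSet_singleton 1)
  have h1 : P ({ω | α i j ω = 1} ∪ {ω | α i j ω = 0}) = 1 := by
    rw [measure_union _ m0, h.prob_one i j hij, h.prob_zero i j hij,
      ← ENNReal.ofReal_add hp0 (by linarith)]
    · simp
    · rw [Set.disjoint_left]
      intro ω h1 h0
      simp only [Set.mem_ofPred_eq] at h1 h0
      linarith
  have h2 : ∀ᵐ ω ∂P, ω ∈ {ω | α i j ω = 1} ∪ {ω | α i j ω = 0} :=
    (prob_compl_eq_zero_iff (m1.union m0)).2 h1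
  filter_upwards [h2] with ω hω _
  rcases hω with hω | hω <;> simp only [Set.mem_ofPred_eq] at hω <;> simp [mark, rel, hij, hω]

end IsBernoulliEdgeFamily

end WeightedBarakErdos

theorem mainTheorem6 (p : ℝ) (hp0 : 0 < p) (hp1 : p < 1) :
    ∃ (CBot : ℝ) (C : ℝ → ℝ),
      0 < CBot ∧ (∀ x : ℝ, 0 < C x ∧ CBot ≤ C x) ∧
      ∀ (Ω : Type u) [MeasurableSpace Ω] (P : Measure Ω) [IsProbabilityMeasure P]
        (α : ℤ → ℤ → Ω → ℝ), WeightedBarakErdos.IsBernoulliEdgeFamily P p α →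
        WeightedBarakErdos.TendstoAS P
          (fun n ω => WeightedBarakErdos.WBotPos α 0 n ω / n) CBot ∧
        ∀ x : ℝ,
          WeightedBarakErdos.TendstoAS P
            (fun n ω => WeightedBarakErdos.W α x 0 n ω / n) (C x) ∧
          WeightedBarakErdos.TendstoL1 P
            (fun n ω => WeightedBarakErdos.W α x 0 n ω / n) (C x) ∧
          WeightedBarakErdos.TendstoAS P
            (fun n ω => max (WeightedBarakErdos.W α x 0 n ω) 0 / n) (C x) ∧
          WeightedBarakErdos.TendstoL1 P
            (fun n ω => max (WeightedBarakErdos.W α x 0 n ω) 0 / n) (C x) := by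
  open WeightedBarakErdos in
  obtain ⟨CBot, C, h0, hC, hBot, hreal⟩ := exists_ae_tendsto_config ⟨p, hp0.le, hp1.le⟩ hp0
  refine ⟨CBot, C, h0, fun x => ⟨h0.trans_le (hC x), hC x⟩, ?_⟩
  intro Ω _ P _ α hα
  obtain ⟨hm, hmap⟩ := IsBernoulliEdgeFamily.map_decide ⟨p, hp0.le, hp1.le⟩ hα
  have hmark := hα.ae_eq_mark hp0.le hp1.le
  set Φ : Ω → Config := fun ω e => decide (α e.1.1 e.1.2 ω = 1) with hΦ
  rw [← hmap] at hBot hreal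
  refine ⟨?_, fun x => ?_⟩
  · filter_upwards [ae_of_ae_map hm.aemeasurable hBot, hmark] with ω h1 h2
    refine h1.congr fun n => ?_
    rw [posMaxBot_congr (a := fun k l => α k l ω) fun k l hkl => (h2 k l hkl).symm]
    rfl
  have hW : ∀ᵐ ω ∂P, ∀ n : ℕ, W α x 0 n ω =
      maxWeight (edgeWeight x fun k l => mark k l (Φ ω)) 0 n := by
    filter_upwards [hmark] with ω h2 n
    exact maxWeight_congr fun k l _ hkl _ => by
      simp only [edgeWeight, h2 k l hkl, hΦ]
  have hAS : TendstoAS P (fun n ω => W α x 0 n ω / n) (C x) := by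
    filter_upwards [ae_of_ae_map hm.aemeasurable (hreal x), hW] with ω h1 h2
    exact h1.congr fun n => by rw [h2]
  have hAS' : TendstoAS P (fun n ω => max (W α x 0 n ω) 0 / n) (C x) := by
    filter_upwards [hAS] with ω h1
    -- As `C x > 0`, taking positive parts does not change the limit.
    have h2 := h1.max (tendsto_const_nhds (x := (0 : ℝ)))
    rw [max_eq_left (h0.trans_le (hC x)).le] at h2
    refine h2.congr fun n => ?_
    rw [← max_div_div_right n.cast_nonneg, zero_div]
  have hmeas : ∀ n : ℕ, AEStronglyMeasurable (fun ω => W α x 0 n ω) P := fun n =>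
    (((isBlockFunctional_maxWeight x).measurable 0 n).comp hm).aestronglyMeasurable.congr (by
      filter_upwards [hW] with ω h
      exact (h n).symm)
  have hbound : ∀ n : ℕ, ∀ᵐ ω ∂P, |W α x 0 n ω / n| ≤ max 1 |x| := fun n => by
    filter_upwards [hW] with ω h
    rcases n.eq_zero_or_pos with rfl | hn
    · simp
    have hn' : (0 : ℝ) < n := by exact_mod_cast hn
    rw [abs_div, Nat.abs_cast, div_le_iff₀ hn', h]
    simpa using (isBlockFunctional_maxWeight x).abs_le 0 n (by simp) (Φ ω)
  refine ⟨hAS, tendstoL1_of_tendstoAS hAS (fun n => ?_) hbound, hAS',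
    tendstoL1_of_tendstoAS (B := max 1 |x|) hAS' (fun n => ?_) fun n => ?_⟩
  · exact (hmeas n).div₀ aestronglyMeasurable_const
  · exact ((hmeas n).sup aestronglyMeasurable_const).div₀ aestronglyMeasurable_const
  · filter_upwards [hbound n] with ω h
    refine le_trans ?_ h
    rw [abs_div, abs_div]
    refine div_le_div_of_nonneg_right ?_ (abs_nonneg _)
    rw [abs_of_nonneg (le_max_right _ _)]
    exact max_le (le_abs_self _) (abs_nonneg _)
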